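/- Let $R$ and $R'$ be finite chain rings (nonzero finite commutative rings whose ideals form a chain), with radicals $J(R)=R\pi$ and $J(R')=R'\pi'$ of nilpotency indices $\ell$ and $\ell'$, and let $\rho:R\to R'$ be a surjective ring homomorphism. Identify their residue fields via $\rho$, $F:=R/R\pi=R'/R'\pi'$; put $q=|F|$ and write $\bar a\in F$ for the residue class of $a\in R$. Let $\lambda\in R^\times$, $\lambda'=\rho(\lambda)$, let $t$ be the order of $\bar\lambda$ in $F^\times$, and let $\alpha,\alpha'>0$ be integers with $\alpha'\equiv\alpha\pmod t$ and $\gcd(\alpha,t)=1$; put $\alpha''=\min\{\alpha',\alpha\}$. For an integer $k$ coprime to $t$, $\bar\lambda^{1/k}$ denotes $\bar\lambda^{j}$ with $jk\equiv1\pmod t$. An $(R',R)$-linear $(\lambda',\lambda)$-constacyclic code of cycle length $(\alpha'n,\alpha n)$ is an $R[X]$-submodule of $\big(R'[X]/\langle X^{\alpha'n}-\lambda'\rangle\big)\times\big(R[X]/\langle X^{\alpha n}-\lambda\rangle\big)$, where $R[X]$ acts on the first factor through $\rho$. Its relative distance is $\Delta(C)=\frac{\mathrm w(C)}{\alpha'n\ell'+\alpha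 n\ell}$, where $\mathrm w(C)$ is the minimum Hamming weight (total number of nonzero coefficients of the two reduced representatives) of a nonzero element of $C$, with $\mathrm w(\{0\})=0$. For $n>1$ coprime to $qt$ and $\beta\in\{\alpha,\alpha'\}$ let $\mathcal I_{\bar\lambda,\beta}$ be the ideal of $F[X]/\langle X^{\beta n}-\bar\lambda\rangle$ generated by $$\Big(\bar\lambda^{-\frac1{\beta n}}X-1\Big)\sum_{j=0}^{\beta-1}(X^n)^{\beta-1-j}\big(\bar\lambda^{\frac1\beta}\big)^j .$$ Choose $(a',a)$ uniformly at random in $\mathcal I_{\bar\lambda,\alpha'}\times\mathcal I_{\bar\lambda,\alpha}$, let $C_{a',a}=F[X]\,(a',a)$ be the $F[X]$-submodule it generates, and let $\tilde C_{a',a}$ be the image of $C_{a',a}$ under the map $$\Big(\sum_{j=0}^{\alpha'n-1}\overline{a'_j}X^j,\ \sum_{j=0}^{\alpha n-1}\overline{a_j}X^j\Big)\longmapsto\Big(\sum_{j=0}^{\alpha'n-1}\rho(a'_j)\,\pi'^{\,\ell'-1}X^j,\ \sum_{j=0}^{\alpha n-1}a_j\,\pi^{\ell-1}X^j\Big)\qquad(a'_j,a_j\in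 R).$$ Let $\mu(n)$ be the least degree of the monic irreducible factors of $X^n-1$ over $F$ other than $X-1$. Let $n_1,n_2,\dots$ be integers with $n_i>1$, $\gcd(n_i,qt)=1$ and $\lim_{i\to\infty}\frac{\log_q n_i}{\mu(n_i)}=0$, and let $\tilde C^{(i)}_{a',a}$ be the random code above for $n=n_i$. Let $h_q(x)=x\log_q(q-1)-x\log_q x-(1-x)\log_q(1-x)$ for $x\in[0,1-q^{-1}]$ (with $0\log_q0=0$), and let $\delta\in(0,1-q^{-1})$ satisfy $\frac{\alpha'+\alpha}{2\alpha''}\delta\le1-q^{-1}$ and $h_q\big(\frac{\alpha'+\alpha}{2\alpha''}\delta\big)<\frac12$. Then every $\tilde C^{(i)}_{a',a}$ is an $(R',R)$-linear $(\lambda',\lambda)$-constacyclic code of cycle length $(\alpha'n_i,\alpha n_i)$, and (1) $\displaystyle\lim_{i\to\infty}\Pr\Big(\Delta\big(\tilde C^{(i)}_{a',a}\big)>\frac{\alpha'+\alpha}{\alpha'\ell'+\alpha\ell}\,\delta\Big)=1$; (2) $\displaystyle\lim_{i\to\infty}\Pr\Big(\big|\tilde C^{(i)}_{a',a}\big|=q^{\,n_i-1}\Big)=1$.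 -/

import Mathlib

open Polynomial Filter Topology

noncomputable section

namespace ConstaCodes

/-! ### Finite chain rings -/

/-- A finite chain ring: a nonzero finite commutative ring whose ideals form a chain. -/
class IsFiniteChainRing (R : Type*) [CommRing R] : Prop where
  finite : Finite R
  nontrivial : Nontrivial R
  ideal_chain : ∀ I J : Ideal R, I ≤ J ∨ J ≤ I

instance IsFiniteChainRing.isLocalRing (R : Type*) [CommRing R] [h : IsFiniteChainRing R] :
    IsLocalRing R := by
  have := h.nontrivial
  refine IsLocalRing.of_isUnit_or_isUnit_one_sub_self (fun a => ?_)
  rcases h.ideal_chain (Ideal.span {a}) (Ideal.span {1 - a}) with h1 | h1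
  · right
    rw [Ideal.span_singleton_le_span_singleton] at h1
    have h2 : (1 - a) ∣ 1 := by
      have h3 := dvd_add h1 (dvd_refl (1 - a))
      simpa using h3
    exact isUnit_of_dvd_one h2
  · left
    rw [Ideal.span_singleton_le_span_singleton] at h1
    have h2 : a ∣ 1 := by
      have h3 := dvd_add h1 (dvd_refl a)
      simpa using h3
    exact isUnit_of_dvd_one h2

/-! ### Constacyclic ambient rings, double constacyclic codes and weights -/

/-- The quotient ring `R[X] / ⟨X ^ N - l⟩`. -/
abbrev ConstaRing (R : Type*) [CommRing R] (N : ℕ) (l : R) : Type _ :=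
  R[X] ⧸ Ideal.span {(X ^ N - C l : R[X])}

/-- The canonical representative (of degree `< N`, for `N > 0`) of an element of
`R[X] / ⟨X ^ N - l⟩`; it does not depend on the representative that is divided. -/
def rep {R : Type*} [CommRing R] {N : ℕ} {l : R} (x : ConstaRing R N l) : R[X] :=
  Function.surjInv Ideal.Quotient.mk_surjective x %ₘ (X ^ N - C l)

/-- The Hamming weight of an element of `R[X] / ⟨X ^ N - l⟩`, i.e. the number of nonzero entries
of its word `(c_0, …, c_{N-1})` of coefficients. -/
def weight {R : Type*} [CommRing R] {N : ℕ} {l : R} (x : ConstaRing R N l) : ℕ :=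
  (rep x).support.card

/-- The space `(R'[X] / ⟨X ^ N' - ρ l⟩) × (R[X] / ⟨X ^ N - l⟩)`. -/
def DoubleSpace {R R' : Type*} [CommRing R] [CommRing R'] (ρ : R →+* R') (l : R) (N' N : ℕ) :
    Type _ :=
  ConstaRing R' N' (ρ l) × ConstaRing R N l

instance {R R' : Type*} [CommRing R] [CommRing R'] (ρ : R →+* R') (l : R) (N' N : ℕ) :
    AddCommGroup (DoubleSpace ρ l N' N) :=
  inferInstanceAs (AddCommGroup (ConstaRing R' N' (ρ l) × ConstaRing R N l))

/-- `g(X) • (a', a) = ((ρ g)(X) a', g(X) a)`. -/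
instance {R R' : Type*} [CommRing R] [CommRing R'] (ρ : R →+* R') (l : R) (N' N : ℕ) :
    Module R[X] (DoubleSpace ρ l N' N) :=
  Module.compHom (ConstaRing R' N' (ρ l) × ConstaRing R N l)
    (((Ideal.Quotient.mk (Ideal.span {(X ^ N' - C (ρ l) : R'[X])})).comp (mapRingHom ρ)).prod
      (Ideal.Quotient.mk (Ideal.span {(X ^ N - C l : R[X])})))

/-- `(R', R)`-linear `(ρ l, l)`-constacyclic codes of cycle length `(N', N)`. -/
abbrev DoubleCode {R R' : Type*} [CommRing R] [CommRing R'] (ρ : R →+* R') (l : R) (N' N : ℕ) :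
    Type _ :=
  Submodule R[X] (DoubleSpace ρ l N' N)

/-- The minimum Hamming weight of the nonzero words of a code (`0` if there is no such word). -/
def minWeight {R R' : Type*} [CommRing R] [CommRing R'] {ρ : R →+* R'} {l : R} {N' N : ℕ}
    (C : Set (DoubleSpace ρ l N' N)) : ℕ :=
  sInf {w | ∃ c ∈ C, c ≠ 0 ∧ w = weight c.1 + weight c.2}

/-- The relative minimum distance of a linear code over `(R', R)` of cycle length `(N', N)`, where
the radicals of `R'`, `R` have nilpotency indices `e'`, `e`: the code length is `N' e' + N e`. -/
def relDist {R R' : Type*} [CommRing R] [CommRing R'] {ρ : R →+* R'} {l : R} {N' N : ℕ}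
    (e' e : ℕ) (C : Set (DoubleSpace ρ l N' N)) : ℝ :=
  (minWeight C : ℝ) / ((N' : ℝ) * e' + (N : ℝ) * e)

/-! ### The random double twisted codes over a field -/

/-- The element `u ^ (1 / k)` of the cyclic group generated by `u`, where `1 / k` is the inverse
of `k` modulo the order of `u` (`k` coprime to that order). -/
def unitRoot {F : Type*} [Field F] (u : Fˣ) (k : ℕ) : Fˣ :=
  u ^ ((k : ZMod (orderOf u))⁻¹).val

/-- `ψ(X) = ∑_{j < a} (X ^ n) ^ (a - 1 - j) (u ^ (1 / a)) ^ j`. -/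
def psi {F : Type*} [Field F] (u : Fˣ) (a n : ℕ) : F[X] :=
  ∑ j ∈ Finset.range a, (X ^ n) ^ (a - 1 - j) * C ((unitRoot u a : F) ^ j)

/-- `ψ⁺(X) = (X / u ^ (1 / (a n)) - 1) ψ(X)`. -/
def psiPlus {F : Type*} [Field F] (u : Fˣ) (a n : ℕ) : F[X] :=
  (C ((unitRoot u (a * n) : F)⁻¹) * X - 1) * psi u a n

/-- The ideal of `F[X] / ⟨X ^ (a n) - u⟩` generated by `ψ⁺`. -/
def sampleIdeal {F : Type*} [Field F] (u : Fˣ) (a n : ℕ) : Ideal (ConstaRing F (a * n) (u : F)) :=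
  Ideal.span {Ideal.Quotient.mk _ (psiPlus u a n)}

/-- The double twisted code `F[X] (a', a)` over `F` generated by `(a', a)`. -/
def baseCode {F : Type*} [Field F] {u : F} {N' N : ℕ} (a' : ConstaRing F N' u)
    (a : ConstaRing F N u) : DoubleCode (RingHom.id F) u N' N :=
  Submodule.span F[X] {((a', a) : DoubleSpace (RingHom.id F) u N' N)}

/-- The sample space of pairs `(a', a)`. -/
abbrev Sample {F : Type*} [Field F] (u : Fˣ) (α' α n : ℕ) : Type _ :=
  sampleIdeal u α' n × sampleIdeal u α n

/-- Probability of an event in a finite nonempty sample space with equal probabilities. -/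
def uniformProb {Ω : Type*} (E : Ω → Prop) : ℝ :=
  (Nat.card {ω // E ω} : ℝ) / (Nat.card Ω : ℝ)

/-- The least degree of the monic irreducible factors of `X ^ n - 1` other than `X - 1`
(for `n > 1` coprime to the characteristic there are such factors). -/
def minDeg (F : Type*) [Field F] (n : ℕ) : ℕ :=
  sInf {d | ∃ p : F[X], p.Monic ∧ Irreducible p ∧ p ∣ X ^ n - 1 ∧ p ≠ X - 1 ∧ p.natDegree = d}

/-- The `q`-ary entropy function, with logarithms to base `q`. -/
def entropy (q : ℕ) (x : ℝ) : ℝ :=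
  Real.qaryEntropy q x / Real.log q

/-! ### Embedding into codes over the chain rings -/

section Embedding

variable {R : Type*} [CommRing R] [IsLocalRing R]

/-- The image `\bar l` of a unit `l` in the unit group of the residue field. -/
def residueUnit (l : Rˣ) : (IsLocalRing.ResidueField R)ˣ :=
  Units.map (IsLocalRing.residue R : R →* IsLocalRing.ResidueField R) l

/-- A lift of an element of the residue field. -/
def resLift (x : IsLocalRing.ResidueField R) : R :=
  Function.surjInv IsLocalRing.residue_surjective x

/-- The map `∑_{j < N} \bar a_j X ^ j ↦ ∑_{j < N} ρ(a_j) c X ^ j`. For `ρ : R → S` surjective onto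
a local ring, `\bar a ↦ \overline{ρ(a)}` identifies the residue fields; for `c` a generator of the
minimal ideal of a chain ring `S`, the element `ρ(a) c` depends only on `\bar a`. -/
def socleMap {S : Type*} [CommRing S] (ρ : R →+* S) (c : S) {N : ℕ}
    {u : IsLocalRing.ResidueField R} {s : S} (x : ConstaRing (IsLocalRing.ResidueField R) N u) :
    ConstaRing S N s :=
  Ideal.Quotient.mk _ (∑ j ∈ Finset.range N, C (ρ (resLift ((rep x).coeff j)) * c) * X ^ j)

/-- The map of the spaces of pairs, with multipliers `c' ∈ R'` and `c ∈ R`. -/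
def pairMap {R' : Type*} [CommRing R'] (ρ : R →+* R') (c' : R') (c : R)
    {u : IsLocalRing.ResidueField R} (l : R) {N' N : ℕ}
    (x : DoubleSpace (RingHom.id (IsLocalRing.ResidueField R)) u N' N) :
    DoubleSpace ρ l N' N :=
  (socleMap ρ c' x.1, socleMap (RingHom.id R) c x.2)

/-- The image in the code space over `(R', R)` of the code over the residue field generated by
the pair `ω = (a', a)`. -/
def liftedCode {R' : Type*} [CommRing R'] (ρ : R →+* R') (c' : R') (c : R) (l : Rˣ)
    {α' α n : ℕ} (ω : Sample (residueUnit l) α' α n) :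
    Set (DoubleSpace ρ (l : R) (α' * n) (α * n)) :=
  pairMap ρ c' c (l : R) ''
    ((baseCode ω.1.1 ω.2.1 :
        DoubleCode (RingHom.id _) (residueUnit l : IsLocalRing.ResidueField R) (α' * n) (α * n)) :
      Set (DoubleSpace (RingHom.id _) (residueUnit l : IsLocalRing.ResidueField R)
        (α' * n) (α * n)))

end Embedding

end ConstaCodes

end

/-! Since `α' ≡ α` modulo the order of `u`, the same `w = u ^ (1 / (α n))` serves both components.
As `ψ⁺` times `checkPoly w n` is `X ^ (α n) - u`, multiplication by `ψ⁺` embeds the single ring `A =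
F[X] / (checkPoly w n)` onto each sampling ideal (`exists_linearMap_sampleIdeal`). A sample is thus
a uniform pair `(f', f)` in `A × A`, and its code consists of the images of `(h f', h f)` for `h` in
`A`. This ring is reduced of dimension `n - 1`, and its residue fields have at least `q ^ minDeg F
n` elements.

Coefficients of an embedded `y` are values `φ (x ^ k • y)` of one functional. As `x ^ n` acts as a
nonzero scalar, the weight is `α` times the count over one period (`weight_linearMap`).

Fix `h ≠ 0`, let `d = dim A h` and let `δ` be the rescaled distance. Then `h f` is uniform on `A h`,
and any `d` consecutive positions determine an element of `A h`. A low-weight word is low on one of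
the `n` cyclic windows of length `d`, so a Chernoff bound gives probability at most `n |A h| ^ (-(1
+ γ))` with `γ = 1 - 2 h_q(δ) > 0` (`card_low_le`). Summing over `h` through `A ≅ ∏ A / M` gives
failure probability at most `n (exp (n q ^ (-γ minDeg)) - 1)` (`card_exists_low_le`), which vanishes
because `log n / minDeg → 0` (`tendsto_error_zero`).

Off this event no nonzero `h` gives the zero word, so the code has `|A| = q ^ (n - 1)` elements.
Multiplication by the generators of the socles carries it injectively, with its weights, to the
chain rings (`weight_socleMap`). -/

noncomputable section

namespace ConstaCodes

/-! ### Weight enumerator of the full space `F ^ d` -/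

open scoped Classical in
-- The coordinates are independent: each contributes `1` for its zero value and `z` for each of its
-- `q - 1` nonzero values.
theorem sum_pow_hammingNorm {F : Type*} [Field F] [Fintype F] (d : ℕ) (z : ℝ) :
    ∑ w : Fin d → F, z ^ hammingNorm w = (1 + ((Fintype.card F : ℝ) - 1) * z) ^ d := by
  have h1 : ∑ j : F, (if j ≠ 0 then z else 1) = 1 + ((Fintype.card F : ℝ) - 1) * z := by
    rw [← Finset.add_sum_erase _ _ (Finset.mem_univ (0 : F))]
    rw [Finset.sum_congr rfl (g := fun _ => z)]
    · simp [Finset.card_erase_of_mem, Nat.cast_sub Fintype.card_pos]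
    · intro j hj
      simp [Finset.ne_of_mem_erase hj]
  have h2 := Finset.prod_univ_sum (fun _ : Fin d => (Finset.univ : Finset F))
    (fun _ j => if j ≠ 0 then z else (1 : ℝ))
  rw [Fintype.piFinset_univ, h1] at h2
  simp only [Finset.prod_const, Finset.card_univ, Fintype.card_fin] at h2
  rw [h2]
  refine Finset.sum_congr rfl fun w _ => ?_
  rw [Finset.prod_ite]
  simp [hammingNorm]

/-! ### Orbits of a linear functional under multiplication by `x` -/

section Orbit

set_option linter.unusedSectionVars false

variable {F A V : Type*} [Field F] [CommRing A] [Algebra F A] [AddCommGroup V] [Module F V]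
  [Module A V] [IsScalarTower F A V]

open scoped Classical in
/-- The number of `k` in `[s, s + m)` for which the functional `φ` does not vanish at `x ^ k • y`. -/
def orbitCount (x : A) (φ : V →ₗ[F] F) (s m : ℕ) (y : V) : ℕ :=
  {i ∈ Finset.range m | φ (x ^ (s + i) • y) ≠ 0}.card

/-- Any `dim V` consecutive orbit values form an information set, so reading them off embeds `V`
into `F ^ d` and the sum is part of the full weight enumerator. -/
theorem sum_pow_orbitCount_le [Fintype F] [Fintype V] (x : A) (φ : V →ₗ[F] F)
    (hφ : ∀ y : V, (∀ i, φ (x ^ i • y) = 0) → y = 0) (hx : ∀ y : V, x • y = 0 → y = 0)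
    {z : ℝ} (hz : 0 ≤ z) (s : ℕ) :
    ∑ y : V, z ^ orbitCount x φ s (Module.finrank F V) y ≤
      (1 + ((Fintype.card F : ℝ) - 1) * z) ^ Module.finrank F V := by
  classical
  set d := Module.finrank F V with hd
  let T : V →ₗ[F] V := Algebra.lsmul F F V x
  have hT : ∀ (p : F[X]) (y : V), aeval T p y = aeval x p • y := by
    intro p y
    have := Polynomial.aeval_algHom_apply (Algebra.lsmul F F V) x p
    rw [show aeval T p = _ from this]
    rfl
  let e : V → Fin d → F := fun y i => φ (x ^ (s + i) • y)
  have hinj : Function.Injective e := by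
    intro y₁ y₂ h12
    rw [← sub_eq_zero]
    set y := y₁ - y₂ with hy
    have h0 : ∀ i < d, φ (x ^ i • x ^ s • y) = 0 := by
      intro i hi
      have := congrFun h12 ⟨i, hi⟩
      simp only [e] at this
      rw [smul_smul, ← pow_add, add_comm, hy, smul_sub, map_sub, this, sub_self]
    -- By Cayley–Hamilton every power of `x` acts as a combination of the first `d` powers, so `d`
    -- vanishing values force all of them to vanish.
    have hall : ∀ i, φ (x ^ i • x ^ s • y) = 0 := by
      intro i
      have hmon : T.charpoly.Monic := T.charpoly_monic
      have key : x ^ i • x ^ s • y = aeval T ((X ^ i : F[X]) %ₘ T.charpoly) (x ^ s • y) := by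
        have h3 := congrArg (fun p => aeval T p (x ^ s • y))
          (modByMonic_add_div (X ^ i : F[X]) T.charpoly)
        simp only [map_add, map_mul, LinearMap.aeval_self_charpoly, zero_mul, add_zero] at h3
        rw [h3, hT]
        simp
      rw [key, hT, aeval_eq_sum_range, Finset.sum_smul, map_sum]
      refine Finset.sum_eq_zero fun j hj => ?_
      by_cases hjd : j < d
      · rw [smul_assoc, map_smul, h0 j hjd, smul_zero]
      · rw [coeff_eq_zero_of_degree_lt, zero_smul, zero_smul, map_zero]
        refine (degree_modByMonic_lt _ hmon).trans_le ?_
        rw [degree_eq_natDegree hmon.ne_zero, LinearMap.charpoly_natDegree, ← hd]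
        exact_mod_cast not_lt.mp hjd
    have h1 := hφ _ hall
    clear hall h0 h12
    clear_value y
    -- The factor `x ^ s` is cancelled one `x` at a time, using injectivity of `x`.
    induction s with
    | zero => simpa using h1
    | succ s ih =>
      exact ih (hx _ (by rw [smul_smul, ← pow_succ']; exact h1))
  have hcount : ∀ y : V, orbitCount x φ s d y = hammingNorm (e y) := by
    intro y
    simp only [orbitCount, hammingNorm, e]
    rw [Finset.card_filter, Finset.card_filter, Finset.sum_range]
  rw [← sum_pow_hammingNorm]
  simp only [hcount]
  rw [← Finset.sum_image (f := fun w => z ^ hammingNorm w) (fun a _ b _ h => hinj h)]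
  exact Finset.sum_le_sum_of_subset_of_nonneg (Finset.subset_univ _)
    (fun w _ _ => pow_nonneg hz _)

/-- A shift by `n` multiplies the orbit value by `v ≠ 0`, so the pattern of nonvanishing positions
is `n`-periodic. -/
theorem orbitCount_period {x : A} {φ : V →ₗ[F] F} {n : ℕ} {v : F} (hv : v ≠ 0)
    (hx : ∀ y : V, x ^ n • y = v • y) (s : ℕ) (y : V) :
    orbitCount x φ s n y = orbitCount x φ 0 n y := by
  classical
  let p : ℕ → Prop := fun k => φ (x ^ k • y) ≠ 0
  have hp : Function.Periodic p n := by
    intro k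
    simp only [p]
    rw [show k + n = n + k by ring, pow_add, mul_smul, hx, map_smul]
    simp [hv]
  have h : ∀ s, orbitCount x φ s n y = Nat.count p n := by
    intro s
    rw [← Nat.filter_Ico_card_eq_of_periodic s n p hp, orbitCount, Finset.card_filter,
      Finset.card_filter, Finset.sum_Ico_eq_sum_range]
    simp
  rw [h, h]

theorem orbitCount_mul_period {x : A} {φ : V →ₗ[F] F} {n : ℕ} {v : F} (hv : v ≠ 0)
    (hx : ∀ y : V, x ^ n • y = v • y) (a : ℕ) (y : V) :
    orbitCount x φ 0 (a * n) y = a * orbitCount x φ 0 n y := by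
  classical
  induction a with
  | zero => simp [orbitCount]
  | succ a ih =>
    have : orbitCount x φ 0 ((a + 1) * n) y
        = orbitCount x φ 0 (a * n) y + orbitCount x φ (a * n) n y := by
      simp only [orbitCount, Finset.card_filter]
      rw [add_mul, one_mul, Finset.sum_range_add]
      simp
    rw [this, ih, orbitCount_period hv hx (a * n)]
    ring

/-- Double counting: among the `n` cyclic windows of length `d`, each of the `d` offsets runs once
through a full period. -/
theorem sum_orbitCount {x : A} {φ : V →ₗ[F] F} {n : ℕ} {v : F} (hv : v ≠ 0)
    (hx : ∀ y : V, x ^ n • y = v • y) (d : ℕ) (y : V) :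
    ∑ k ∈ Finset.range n, orbitCount x φ k d y = d * orbitCount x φ 0 n y := by
  classical
  have h : ∀ i, ∑ k ∈ Finset.range n, (if φ (x ^ (k + i) • y) ≠ 0 then 1 else 0)
      = orbitCount x φ 0 n y := by
    intro i
    rw [← orbitCount_period hv hx i, orbitCount, Finset.card_filter]
    simp [add_comm]
  simp only [orbitCount, Finset.card_filter] at h ⊢
  rw [Finset.sum_comm, Finset.sum_congr rfl fun i _ => h i]
  simp

theorem orbitCount_map {W : Type*} [AddCommGroup W] [Module F W] [Module A W]
    [IsScalarTower F A W] (x : A) (φ : W →ₗ[F] F) (f : V →ₗ[A] W) (s m : ℕ) (y : V) :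
    orbitCount x (φ ∘ₗ f.restrictScalars F) s m y = orbitCount x φ s m (f y) := by
  classical
  unfold orbitCount
  congr 1
  refine Finset.filter_congr fun i _ => ?_
  rw [← f.map_smul]
  rfl

end Orbit

theorem card_mul_sum_comp {A V : Type*} [AddCommGroup A] [AddCommGroup V] [Fintype A] [Fintype V]
    (g : A →+ V) (hg : Function.Surjective g) (G : V → ℝ) :
    (Fintype.card V : ℝ) * ∑ a, G (g a) = Fintype.card A * ∑ y, G y := by
  classical
  have hc : ∀ y, ({a | g a = y} : Finset A).card = ({a | g a = 0} : Finset A).card := fun y =>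
    AddMonoidHom.card_fiber_eq_of_mem_range g (hg y) (hg 0)
  have h1 : Fintype.card A = Fintype.card V * ({a | g a = 0} : Finset A).card := by
    rw [← Finset.card_univ,
      Finset.card_eq_sum_card_fiberwise (f := g) (t := Finset.univ) (fun _ _ => by simp)]
    simp [hc]
  have h2 : ∑ a, G (g a) = ∑ y, (({a | g a = 0} : Finset A).card : ℝ) * G y := by
    rw [← Finset.sum_fiberwise (s := Finset.univ) (g := g)]
    refine Finset.sum_congr rfl fun y _ => ?_
    rw [Finset.sum_congr rfl (g := fun _ => G y)]
    · rw [Finset.sum_const, hc, nsmul_eq_mul]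
    · intro a ha
      rw [(Finset.mem_filter.mp ha).2]
  rw [h2, ← Finset.mul_sum, h1]
  push_cast
  ring

/-! ### Low-weight probability for a fixed multiplier `h` -/

section Count

variable {F A : Type*} [Field F] [CommRing A] [Algebra F A] [Fintype F] [Fintype A]

/-- The map `f ↦ h * f` onto the ideal of `h` has fibres of equal size, so an average over the ring
is an average over that ideal. -/
theorem card_span_mul_sum_le (x : A) (φ : A →ₗ[F] F)
    (hφ : ∀ y : A, (∀ i, φ (x ^ i • y) = 0) → y = 0) (hx : IsUnit x)
    {z : ℝ} (hz : 0 ≤ z) (h : A) (s : ℕ) :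
    (Nat.card (Ideal.span {h}) : ℝ) *
      ∑ f : A, z ^ orbitCount x φ s (Module.finrank F (Ideal.span {h})) (h * f) ≤
      Fintype.card A *
        (1 + ((Fintype.card F : ℝ) - 1) * z) ^ Module.finrank F (Ideal.span {h}) := by
  classical
  let V := Ideal.span {h}
  have : Fintype V := Fintype.ofFinite V
  let g : A →+ V :=
    { toFun := fun f => ⟨h * f, Ideal.mul_mem_right _ _ (Ideal.mem_span_singleton_self h)⟩
      map_zero' := by ext; simp
      map_add' := fun a b => by ext; simp [mul_add] }
  have hg : Function.Surjective g := by
    rintro ⟨y, hy⟩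
    obtain ⟨a, ha⟩ := Ideal.mem_span_singleton'.mp hy
    exact ⟨a, Subtype.ext (by simp [g, ← ha, mul_comm])⟩
  let ι : V →ₗ[A] A := V.subtype
  have h1 := card_mul_sum_comp g hg
    (fun y => z ^ orbitCount x (φ ∘ₗ ι.restrictScalars F) s (Module.finrank F V) y)
  simp only [orbitCount_map] at h1
  have h2 := sum_pow_orbitCount_le x (φ ∘ₗ ι.restrictScalars F) (fun y hy => by
      have := hφ (ι y) (fun i => by simpa using hy i)
      exact Subtype.ext this)
    (fun y hy => by
      have h3 : x * (y : A) = 0 := congrArg Subtype.val hy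
      exact Subtype.ext ((hx.mul_right_eq_zero).mp h3)) hz s
  simp only [orbitCount_map] at h2
  rw [Nat.card_eq_fintype_card]
  refine h1.le.trans ?_
  gcongr

set_option maxHeartbeats 600000 in
open scoped Classical in
-- Chernoff bound on windows of length `d = dim A h`. The two components are independent, which
-- squares the one-component bound; the factor `n` pays for the unknown window.
theorem card_low_le {x : A} {φ φ' : A →ₗ[F] F}
    (hφ : ∀ y : A, (∀ i, φ (x ^ i • y) = 0) → y = 0)
    (hφ' : ∀ y : A, (∀ i, φ' (x ^ i • y) = 0) → y = 0)
    {n : ℕ} (hn : 0 < n) {v : F} (hv : v ≠ 0) (hxn : x ^ n = algebraMap F A v)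
    {z : ℝ} (hz : 0 < z) (hz1 : z ≤ 1) {δ : ℝ} (h : A) :
    (({f : A × A | ((orbitCount x φ' 0 n (h * f.1) + orbitCount x φ 0 n (h * f.2) : ℕ) : ℝ)
        ≤ 2 * n * δ} : Finset (A × A)).card : ℝ) * (Nat.card (Ideal.span {h}) : ℝ) ^ 2 ≤
      n * (Fintype.card A : ℝ) ^ 2 *
        ((1 + ((Fintype.card F : ℝ) - 1) * z) * z ^ (-δ)) ^
          (2 * Module.finrank F (Ideal.span {h})) := by
  set d := Module.finrank F (Ideal.span {h}) with hd
  have hx : IsUnit x := by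
    refine (isUnit_pow_iff hn.ne').mp ?_
    rw [hxn]
    exact (isUnit_iff_ne_zero.mpr hv).map _
  have hxs : ∀ y : A, x ^ n • y = v • y := fun y => by
    rw [hxn, algebraMap_smul]
  set S := ({f : A × A | ((orbitCount x φ' 0 n (h * f.1) + orbitCount x φ 0 n (h * f.2) : ℕ) : ℝ)
        ≤ 2 * n * δ} : Finset (A × A)) with hS
  let G : ℕ → A × A → ℝ := fun k f =>
    z ^ orbitCount x φ' k d (h * f.1) * z ^ orbitCount x φ k d (h * f.2)
  have hG0 : ∀ k f, 0 ≤ G k f := fun k f => by positivity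
  have h1 : ∀ f ∈ S, z ^ (2 * d * δ) ≤ ∑ k ∈ Finset.range n, G k f := by
    intro f hf
    rw [hS, Finset.mem_filter] at hf
    have hle : ∑ k ∈ Finset.range n,
        ((orbitCount x φ' k d (h * f.1) + orbitCount x φ k d (h * f.2) : ℕ) : ℝ) ≤
        ∑ k ∈ Finset.range n, 2 * d * δ := by
      rw [← Nat.cast_sum, Finset.sum_add_distrib, sum_orbitCount hv hxs, sum_orbitCount hv hxs,
        ← mul_add, Nat.cast_mul]
      simp only [Finset.sum_const, Finset.card_range, nsmul_eq_mul]
      calc _ ≤ (d : ℝ) * (2 * n * δ) := by gcongr; exact hf.2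
        _ = _ := by ring
    -- Some window is no heavier than the average one, and the same `k` is used for both components.
    obtain ⟨k, hk, hkle⟩ := Finset.exists_le_of_sum_le (Finset.nonempty_range_iff.mpr hn.ne') hle
    refine le_trans ?_ (Finset.single_le_sum (f := fun k => G k f) (fun k _ => hG0 k f) hk)
    simp only [G]
    rw [← pow_add, ← Real.rpow_natCast]
    exact Real.rpow_le_rpow_of_exponent_ge hz hz1 hkle
  have h2 : (S.card : ℝ) * z ^ (2 * d * δ) ≤ ∑ k ∈ Finset.range n, ∑ f : A × A, G k f := by
    rw [Finset.sum_comm]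
    calc _ = ∑ f ∈ S, z ^ (2 * d * δ) := by simp
      _ ≤ ∑ f ∈ S, ∑ k ∈ Finset.range n, G k f := Finset.sum_le_sum h1
      _ ≤ _ := Finset.sum_le_sum_of_subset_of_nonneg (Finset.subset_univ _)
        (fun f _ _ => Finset.sum_nonneg fun k _ => hG0 k f)
  set c : ℝ := (Nat.card (Ideal.span {h}) : ℝ)
  set b : ℝ := 1 + ((Fintype.card F : ℝ) - 1) * z with hb
  have hb0 : 0 ≤ b := by
    have : (1 : ℝ) ≤ Fintype.card F := by exact_mod_cast Fintype.card_pos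
    have := mul_nonneg (sub_nonneg.mpr this) hz.le
    linarith
  have h3 : ∀ k, (∑ f : A × A, G k f) * c ^ 2 ≤ ((Fintype.card A : ℝ) * b ^ d) ^ 2 := by
    intro k
    rw [Fintype.sum_prod_type]
    simp only [G]
    rw [← Finset.sum_mul_sum, sq, sq]
    calc _ = (c * ∑ f : A, z ^ orbitCount x φ' k d (h * f)) *
          (c * ∑ f : A, z ^ orbitCount x φ k d (h * f)) := by ring
      _ ≤ _ := mul_le_mul (card_span_mul_sum_le x φ' hφ' hx hz.le h k)
          (card_span_mul_sum_le x φ hφ hx hz.le h k) (by positivity) (by positivity)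
  have h4 : (S.card : ℝ) * z ^ (2 * d * δ) * c ^ 2 ≤ n * ((Fintype.card A : ℝ) * b ^ d) ^ 2 := by
    calc _ ≤ (∑ k ∈ Finset.range n, ∑ f : A × A, G k f) * c ^ 2 := by gcongr
      _ = ∑ k ∈ Finset.range n, (∑ f : A × A, G k f) * c ^ 2 := Finset.sum_mul _ _ _
      _ ≤ ∑ k ∈ Finset.range n, ((Fintype.card A : ℝ) * b ^ d) ^ 2 :=
        Finset.sum_le_sum fun k _ => h3 k
      _ = _ := by simp
  have hzz : (z ^ (-δ)) ^ (2 * d) = (z ^ (2 * d * δ))⁻¹ := by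
    rw [← Real.rpow_natCast, ← Real.rpow_mul hz.le, ← Real.rpow_neg hz.le]
    congr 1
    push_cast
    ring
  have hpos : 0 < z ^ (2 * d * δ) := Real.rpow_pos_of_pos hz _
  rw [mul_pow, hzz, ← mul_assoc, ← div_eq_mul_inv, le_div_iff₀ hpos]
  calc _ = (S.card : ℝ) * z ^ (2 * d * δ) * c ^ 2 := by ring
    _ ≤ _ := h4
    _ = _ := by ring

end Count

/-- The witness is the critical point of the left side in `z`; it is at most `1` exactly when `δ ≤ 1
- 1 / q`. -/
theorem exists_entropy_base {q : ℕ} (hq : 2 ≤ q) {δ : ℝ} (hδ0 : 0 < δ)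
    (hδ1 : δ ≤ 1 - (q : ℝ)⁻¹) :
    ∃ z : ℝ, 0 < z ∧ z ≤ 1 ∧
      (1 + ((q : ℝ) - 1) * z) * z ^ (-δ) = (q : ℝ) ^ entropy q δ := by
  have hq' : (2 : ℝ) ≤ q := by exact_mod_cast hq
  have hq1 : 0 < (q : ℝ) - 1 := by linarith
  have hq0 : 0 < (q : ℝ) := by linarith
  have hδ2 : 0 < 1 - δ := by
    have : 0 < (q : ℝ)⁻¹ := by positivity
    linarith
  refine ⟨δ / ((1 - δ) * (q - 1)), by positivity, ?_, ?_⟩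
  · rw [div_le_one (by positivity)]
    have : δ * q ≤ q - 1 := by
      calc δ * q ≤ (1 - (q : ℝ)⁻¹) * q := by gcongr
        _ = q - 1 := by field_simp
    nlinarith
  · have h1 : 1 + ((q : ℝ) - 1) * (δ / ((1 - δ) * (q - 1))) = (1 - δ)⁻¹ := by
      field_simp
      ring
    have hlogq : 0 < Real.log q := Real.log_pos (by linarith)
    rw [h1, ← Real.exp_log (inv_pos.mpr hδ2), Real.rpow_def_of_pos (by positivity),
      Real.rpow_def_of_pos hq0, ← Real.exp_add, entropy, mul_div_cancel₀ _ hlogq.ne']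
    congr 1
    rw [Real.qaryEntropy, Real.binEntropy_eq_negMulLog_add_negMulLog_one_sub, Real.negMulLog,
      Real.negMulLog, Real.log_inv, Real.log_div hδ0.ne' (by positivity),
      Real.log_mul hδ2.ne' hq1.ne']
    push_cast
    ring

/-! ### Union bound over all multipliers in a finite reduced ring -/

section Reduced

theorem natCard_span_singleton {A : Type*} [CommRing A] (h : A) :
    Nat.card (Ideal.span {h}) = Nat.card (Set.range fun a : A => a * h) := by
  have : ((Ideal.span {h} : Ideal A) : Set A) = Set.range fun a : A => a * h := by
    ext y
    simp [Ideal.mem_span_singleton']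
  exact congrArg (fun s : Set A => Nat.card s) this

theorem natCard_span_singleton_equiv {A B : Type*} [CommRing A] [CommRing B] (e : A ≃+* B)
    (h : A) : Nat.card (Ideal.span {e h}) = Nat.card (Ideal.span {h}) := by
  rw [natCard_span_singleton, natCard_span_singleton,
    ← Nat.card_image_of_injective e.injective]
  congr 2
  ext y
  simp only [Set.mem_range, Set.mem_image, exists_exists_eq_and, map_mul]
  exact (e.surjective.exists (p := fun b => b * e h = y))

open scoped Classical in
theorem natCard_span_singleton_pi {ι : Type*} [Fintype ι] {K : ι → Type*} [∀ i, Field (K i)]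
    (h : ∀ i, K i) :
    Nat.card (Ideal.span {h}) = ∏ i, if h i = 0 then 1 else Nat.card (K i) := by
  rw [natCard_span_singleton]
  have h1 : (Set.range fun a : ∀ i, K i => a * h) =
      Set.pi Set.univ fun i => Set.range fun a : K i => a * h i := by
    ext y
    simp only [Set.mem_range, Set.mem_pi, Set.mem_univ, true_imp_iff]
    constructor
    · rintro ⟨a, rfl⟩ i
      exact ⟨a i, rfl⟩
    · intro hy
      choose a ha using hy
      exact ⟨a, funext ha⟩
  rw [h1, Nat.card_congr (Equiv.Set.univPi _), Nat.card_pi]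
  refine Finset.prod_congr rfl fun i _ => ?_
  split_ifs with h0
  · simp [h0]
  · have : (Set.range fun a : K i => a * h i) = Set.univ :=
      Set.range_eq_univ.mpr (mul_right_surjective₀ h0)
    rw [this, Nat.card_univ]

/-- The size of a principal ideal is multiplicative over coordinates, so the sum factors; the factor
at `K` is `1 + (|K| - 1) |K| ^ (-(1 + γ)) ≤ 1 + |K| ^ (-γ)`. -/
theorem sum_natCard_span_rpow_pi_le {ι : Type*} [Fintype ι] [DecidableEq ι] {K : ι → Type*}
    [∀ i, Field (K i)] [∀ i, Fintype (K i)] {Q γ : ℝ} (hQ : 1 ≤ Q) (hγ : 0 ≤ γ)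
    (hK : ∀ i, Q ≤ Nat.card (K i)) :
    ∑ h : ∀ i, K i, (Nat.card (Ideal.span {h}) : ℝ) ^ (-(1 + γ)) ≤
      (1 + Q ^ (-γ)) ^ Fintype.card ι := by
  classical
  have h1 : ∀ h : ∀ i, K i, (Nat.card (Ideal.span {h}) : ℝ) ^ (-(1 + γ)) =
      ∏ i, if h i = 0 then 1 else (Nat.card (K i) : ℝ) ^ (-(1 + γ)) := by
    intro h
    rw [natCard_span_singleton_pi, Nat.cast_prod,
      ← Real.finsetProd_rpow _ _ (fun i _ => Nat.cast_nonneg _)]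
    refine Finset.prod_congr rfl fun i _ => ?_
    split_ifs <;> simp
  simp only [h1]
  have h2 := Finset.prod_univ_sum (fun i : ι => (Finset.univ : Finset (K i)))
    (fun i j => if j = 0 then 1 else (Nat.card (K i) : ℝ) ^ (-(1 + γ)))
  rw [Fintype.piFinset_univ] at h2
  rw [← h2, ← Finset.card_univ, ← Finset.prod_const]
  refine Finset.prod_le_prod (fun i _ => Finset.sum_nonneg fun j _ => ?_) (fun i _ => ?_)
  · split_ifs <;> positivity
  · have hc : (0 : ℝ) < Nat.card (K i) := by linarith [hK i]
    rw [← Finset.add_sum_erase _ _ (Finset.mem_univ (0 : K i)), if_pos rfl,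
      Finset.sum_congr rfl (g := fun _ => (Nat.card (K i) : ℝ) ^ (-(1 + γ)))
        (fun j hj => if_neg (Finset.ne_of_mem_erase hj))]
    rw [Finset.sum_const, nsmul_eq_mul]
    gcongr
    calc _ ≤ (Nat.card (K i) : ℝ) * (Nat.card (K i) : ℝ) ^ (-(1 + γ)) := by
          gcongr
          rw [Nat.card_eq_fintype_card]
          exact Finset.card_le_univ _
      _ = (Nat.card (K i) : ℝ) ^ (-γ) := by
          rw [neg_add, Real.rpow_add hc, Real.rpow_neg_one, ← mul_assoc,
            mul_inv_cancel₀ hc.ne', one_mul]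
      _ ≤ Q ^ (-γ) :=
          Real.rpow_le_rpow_of_nonpos (by linarith) (hK i) (by linarith)

theorem sum_natCard_span_rpow_le {A : Type*} [CommRing A] [Fintype A] [IsReduced A] {Q γ : ℝ}
    (hQ : 1 ≤ Q) (hγ : 0 ≤ γ) (hA : ∀ M : Ideal A, M.IsMaximal → Q ≤ Nat.card (A ⧸ M)) :
    ∑ h : A, (Nat.card (Ideal.span {h}) : ℝ) ^ (-(1 + γ)) ≤
      (1 + Q ^ (-γ)) ^ Nat.card (MaximalSpectrum A) := by
  classical
  have : Finite (MaximalSpectrum A) := inferInstance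
  have : Fintype (MaximalSpectrum A) := Fintype.ofFinite _
  have (M : MaximalSpectrum A) : Fintype (A ⧸ M.asIdeal) := Fintype.ofFinite _
  let _ (M : MaximalSpectrum A) : Field (A ⧸ M.asIdeal) :=
    have := M.isMaximal
    Ideal.Quotient.field _
  let e : A ≃+* ∀ M : MaximalSpectrum A, A ⧸ M.asIdeal := (IsArtinianRing.equivPi A).toRingEquiv
  have h1 := sum_natCard_span_rpow_pi_le (K := fun M : MaximalSpectrum A => A ⧸ M.asIdeal)
    hQ hγ (fun M => hA _ M.isMaximal)
  rw [Nat.card_eq_fintype_card]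
  refine le_of_eq_of_le ?_ h1
  rw [← e.toEquiv.sum_comp]
  refine Finset.sum_congr rfl fun h _ => ?_
  rw [← natCard_span_singleton_equiv e h]
  rfl

/-- The ring is the product of its residue fields, each of which contains a copy of `F`. -/
theorem card_maximalSpectrum_le (F : Type*) {A : Type*} [Field F] [Finite F] [CommRing A]
    [Algebra F A] [Finite A] [IsReduced A] :
    Nat.card (MaximalSpectrum A) ≤ Module.finrank F A := by
  classical
  have : Finite (MaximalSpectrum A) := inferInstance
  have : Fintype (MaximalSpectrum A) := Fintype.ofFinite _
  have hF : 1 < Nat.card F := Finite.one_lt_card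
  rw [← Nat.pow_le_pow_iff_right hF, ← Module.natCard_eq_pow_finrank,
    Nat.card_congr (IsArtinianRing.equivPi A).toEquiv, Nat.card_pi,
    Nat.card_eq_fintype_card (α := MaximalSpectrum A), ← Finset.card_univ, ← Finset.prod_const]
  refine Finset.prod_le_prod' fun M _ => ?_
  have := M.isMaximal
  have : Nontrivial (A ⧸ M.asIdeal) := Ideal.Quotient.nontrivial_iff.mpr this.ne_top
  have : Finite (A ⧸ M.asIdeal) := Finite.of_surjective _ Ideal.Quotient.mk_surjective
  exact Nat.card_le_card_of_injective (algebraMap F (A ⧸ M.asIdeal)) (algebraMap F _).injective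

open scoped Classical in
theorem card_exists_low_le {F A : Type*} [Field F] [CommRing A] [Algebra F A] [Fintype F]
    [Fintype A] [IsReduced A] {x : A} {φ φ' : A →ₗ[F] F}
    (hφ : ∀ y : A, (∀ i, φ (x ^ i • y) = 0) → y = 0)
    (hφ' : ∀ y : A, (∀ i, φ' (x ^ i • y) = 0) → y = 0)
    {n : ℕ} (hn : 0 < n) {v : F} (hv : v ≠ 0) (hxn : x ^ n = algebraMap F A v)
    {δ : ℝ} (hδ0 : 0 < δ) (hδ1 : δ ≤ 1 - (Fintype.card F : ℝ)⁻¹)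
    (hent : entropy (Fintype.card F) δ ≤ 1 / 2) {Q : ℝ} (hQ : 1 ≤ Q)
    (hA : ∀ M : Ideal A, M.IsMaximal → Q ≤ Nat.card (A ⧸ M)) (hdim : Module.finrank F A ≤ n) :
    (({f : A × A | ∃ h : A, h ≠ 0 ∧
      ((orbitCount x φ' 0 n (h * f.1) + orbitCount x φ 0 n (h * f.2) : ℕ) : ℝ)
        ≤ 2 * n * δ} : Finset (A × A)).card : ℝ) ≤
      (Fintype.card A : ℝ) ^ 2 *
        (n * (Real.exp (n * Q ^ (-(1 - 2 * entropy (Fintype.card F) δ))) - 1)) := by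
  set η := entropy (Fintype.card F) δ with hη
  set γ := 1 - 2 * η with hγ
  have hγ0 : 0 ≤ γ := by linarith
  obtain ⟨z, hz, hz1, hzη⟩ := exists_entropy_base (Fintype.one_lt_card (α := F)) hδ0 hδ1
  let S : A → Finset (A × A) := fun h => {f : A × A |
    ((orbitCount x φ' 0 n (h * f.1) + orbitCount x φ 0 n (h * f.2) : ℕ) : ℝ) ≤ 2 * n * δ}
  have hS : ∀ h, ((S h).card : ℝ) ≤ (Fintype.card A : ℝ) ^ 2 *
      (n * (Nat.card (Ideal.span {h}) : ℝ) ^ (-(1 + γ))) := by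
    intro h
    have h1 := card_low_le hφ hφ' hn hv hxn hz hz1 (δ := δ) h
    rw [hzη] at h1
    set d := Module.finrank F (Ideal.span {h}) with hd
    have hq0 : (0 : ℝ) < Fintype.card F := by exact_mod_cast Fintype.card_pos
    have hc : (Nat.card (Ideal.span {h}) : ℝ) = (Fintype.card F : ℝ) ^ (d : ℝ) := by
      rw [Module.natCard_eq_pow_finrank (K := F), Nat.card_eq_fintype_card, Real.rpow_natCast]
      push_cast
      rfl
    have hc0 : (0 : ℝ) < Nat.card (Ideal.span {h}) := by rw [hc]; positivity
    have h2 : ((Fintype.card F : ℝ) ^ entropy (Fintype.card F) δ) ^ (2 * d) =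
        (Nat.card (Ideal.span {h}) : ℝ) ^ (2 * η) := by
      rw [hc, ← Real.rpow_natCast, ← Real.rpow_mul hq0.le, ← Real.rpow_mul hq0.le]
      congr 1
      push_cast
      ring
    rw [h2, ← le_div_iff₀ (by positivity)] at h1
    refine h1.trans_eq ?_
    rw [mul_div_assoc, ← Real.rpow_natCast (Nat.card (Ideal.span {h}) : ℝ) 2, ← Real.rpow_sub hc0,
      show -(1 + γ) = 2 * η - ((2 : ℕ) : ℝ) by push_cast; linarith]
    ring
  have hsub : ({f : A × A | ∃ h : A, h ≠ 0 ∧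
      ((orbitCount x φ' 0 n (h * f.1) + orbitCount x φ 0 n (h * f.2) : ℕ) : ℝ)
        ≤ 2 * n * δ} : Finset (A × A)) ⊆ (Finset.univ.erase 0).biUnion S := by
    intro f hf
    obtain ⟨h, h0, hle⟩ := (Finset.mem_filter.mp hf).2
    simp only [Finset.mem_biUnion, Finset.mem_erase, Finset.mem_univ, and_true]
    exact ⟨h, h0, Finset.mem_filter.mpr ⟨Finset.mem_univ _, hle⟩⟩
  have h3 : ∑ h ∈ Finset.univ.erase (0 : A), (Nat.card (Ideal.span {h}) : ℝ) ^ (-(1 + γ)) ≤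
      Real.exp (n * Q ^ (-γ)) - 1 := by
    have h4 := sum_natCard_span_rpow_le hQ hγ0 hA
    rw [← Finset.add_sum_erase _ _ (Finset.mem_univ (0 : A))] at h4
    -- The excluded multiplier `h = 0` contributes exactly `1`; this is the `- 1` in the bound.
    have h5 : (Nat.card (Ideal.span {(0 : A)}) : ℝ) ^ (-(1 + γ)) = 1 := by
      rw [natCard_span_singleton]
      simp
    have hQ0 : 0 ≤ Q ^ (-γ) := Real.rpow_nonneg (by linarith) _
    have h6 : (1 + Q ^ (-γ)) ^ Nat.card (MaximalSpectrum A) ≤ Real.exp (n * Q ^ (-γ)) := by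
      calc _ ≤ (1 + Q ^ (-γ)) ^ n :=
            pow_le_pow_right₀ (by linarith) ((card_maximalSpectrum_le F).trans hdim)
        _ ≤ (Real.exp (Q ^ (-γ))) ^ n := by
            gcongr
            linarith [Real.add_one_le_exp (Q ^ (-γ))]
        _ = _ := by rw [← Real.exp_nat_mul]
    linarith
  calc _ ≤ (((Finset.univ.erase 0).biUnion S).card : ℝ) := by
        exact_mod_cast Finset.card_le_card hsub
    _ ≤ ∑ h ∈ Finset.univ.erase (0 : A), ((S h).card : ℝ) := by
        exact_mod_cast Finset.card_biUnion_le
    _ ≤ ∑ h ∈ Finset.univ.erase (0 : A), (Fintype.card A : ℝ) ^ 2 *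
      (n * (Nat.card (Ideal.span {h}) : ℝ) ^ (-(1 + γ))) := Finset.sum_le_sum fun h _ => hS h
    _ = (Fintype.card A : ℝ) ^ 2 * (n * ∑ h ∈ Finset.univ.erase (0 : A),
        (Nat.card (Ideal.span {h}) : ℝ) ^ (-(1 + γ))) := by
        rw [← Finset.mul_sum, ← Finset.mul_sum]
    _ ≤ _ := by gcongr

end Reduced

/-! ### Canonical representatives and their coefficients -/

section Rep

variable {R : Type*} [CommRing R] {N : ℕ} {l : R}

theorem rep_mk (hN : N ≠ 0) (p : R[X]) :
    rep (Ideal.Quotient.mk _ p : ConstaRing R N l) = p %ₘ (X ^ N - C l) := by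
  unfold rep
  refine (modByMonic_eq_of_dvd_sub (monic_X_pow_sub_C l hN) ?_)
  rw [← Ideal.mem_span_singleton, ← Ideal.Quotient.mk_eq_mk_iff_sub_mem]
  exact Function.surjInv_eq Ideal.Quotient.mk_surjective _

theorem mk_modByMonic (p : R[X]) :
    (Ideal.Quotient.mk _ (p %ₘ (X ^ N - C l)) : ConstaRing R N l) = Ideal.Quotient.mk _ p := by
  rw [Ideal.Quotient.mk_eq_mk_iff_sub_mem, Ideal.mem_span_singleton]
  refine ⟨-(p /ₘ (X ^ N - C l)), ?_⟩
  have := modByMonic_add_div p (X ^ N - C l)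
  linear_combination this

theorem mk_rep (x : ConstaRing R N l) : (Ideal.Quotient.mk _ (rep x) : ConstaRing R N l) = x := by
  unfold rep
  rw [mk_modByMonic]
  exact Function.surjInv_eq Ideal.Quotient.mk_surjective _

theorem degree_rep_lt [Nontrivial R] (hN : N ≠ 0) (x : ConstaRing R N l) :
    (rep x).degree < N := by
  refine (degree_modByMonic_lt _ (monic_X_pow_sub_C l hN)).trans_eq ?_
  exact degree_X_pow_sub_C (Nat.pos_of_ne_zero hN) l

theorem rep_mk_of_degree_lt [Nontrivial R] (hN : N ≠ 0) {p : R[X]} (hp : p.degree < N) :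
    rep (Ideal.Quotient.mk _ p : ConstaRing R N l) = p := by
  rw [rep_mk hN, (modByMonic_eq_self_iff (monic_X_pow_sub_C l hN)).mpr]
  rwa [degree_X_pow_sub_C (Nat.pos_of_ne_zero hN) l]

theorem rep_add (hN : N ≠ 0) (x y : ConstaRing R N l) : rep (x + y) = rep x + rep y := by
  obtain ⟨p, rfl⟩ := Ideal.Quotient.mk_surjective x
  obtain ⟨r, rfl⟩ := Ideal.Quotient.mk_surjective y
  rw [← map_add, rep_mk hN, rep_mk hN, rep_mk hN, add_modByMonic]

theorem rep_smul (hN : N ≠ 0) (c : R) (x : ConstaRing R N l) : rep (c • x) = c • rep x := by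
  obtain ⟨p, rfl⟩ := Ideal.Quotient.mk_surjective x
  have : c • (Ideal.Quotient.mk _ p : ConstaRing R N l) = Ideal.Quotient.mk _ (c • p) := rfl
  rw [this, rep_mk hN, rep_mk hN, smul_modByMonic]

theorem rep_eq_zero {x : ConstaRing R N l} (h : rep x = 0) : x = 0 := by
  rw [← mk_rep x, h, map_zero]

theorem weight_eq_zero {x : ConstaRing R N l} (h : weight x = 0) : x = 0 := by
  apply rep_eq_zero
  rwa [weight, Finset.card_eq_zero, support_eq_empty] at h

/-- The functional that reads the coefficient of `X ^ (N - 1)`. -/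
def topCoeff (hN : N ≠ 0) : ConstaRing R N l →ₗ[R] R where
  toFun x := (rep x).coeff (N - 1)
  map_add' x y := by rw [rep_add hN, coeff_add]
  map_smul' c x := by rw [rep_smul hN, coeff_smul]; rfl

/-- Multiplication by `X ^ k` moves the coefficient at `N - 1 - k` to the top. The part `b` that
wraps around lands in degrees below `k`, hence below `N - 1` or nowhere. -/
theorem topCoeff_X_pow_smul [Nontrivial R] (hN : N ≠ 0) (x : ConstaRing R N l) {k : ℕ}
    (hk : k < N) :
    topCoeff hN ((X : R[X]) ^ k • x) = (rep x).coeff (N - 1 - k) := by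
  set r := rep x with hr
  have hrd : r.natDegree ≤ N - 1 := by
    by_cases h0 : r = 0
    · simp [h0]
    · have := (natDegree_lt_iff_degree_lt h0).mpr (degree_rep_lt hN x)
      omega
  have hm : (X ^ (N - k) : R[X]).Monic := monic_X_pow _
  set a := r %ₘ X ^ (N - k) with ha
  set b := r /ₘ X ^ (N - k) with hb
  have hab : a + X ^ (N - k) * b = r := modByMonic_add_div r _
  have hbd : b.natDegree ≤ k - 1 := by
    rw [hb, natDegree_divByMonic _ hm, natDegree_X_pow]
    omega
  have had : a.degree < (N - k : ℕ) := by
    refine (degree_modByMonic_lt _ hm).trans_eq ?_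
    rw [degree_X_pow]
  have hs : (X : R[X]) ^ k • x = Ideal.Quotient.mk _ (X ^ k * a + C l * b) := by
    conv_lhs => rw [← mk_rep x, ← hr]
    change (Ideal.Quotient.mk _ (X ^ k * r) : ConstaRing R N l) = _
    rw [Ideal.Quotient.mk_eq_mk_iff_sub_mem, Ideal.mem_span_singleton]
    refine ⟨b, ?_⟩
    have hX : (X : R[X]) ^ N = X ^ k * X ^ (N - k) := by rw [← pow_add]; congr 1; omega
    rw [hX, ← hab]
    ring
  have hdeg : (X ^ k * a + C l * b).degree < (N : WithBot ℕ) := by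
    refine lt_of_le_of_lt (degree_add_le _ _) (max_lt ?_ ?_)
    · rw [mul_comm, (monic_X_pow k).degree_mul, degree_X_pow]
      by_cases h0 : a = 0
      · rw [h0]; simp
      · rw [degree_eq_natDegree h0] at had ⊢
        have : a.natDegree < N - k := by exact_mod_cast had
        exact_mod_cast (by omega : a.natDegree + k < N)
    · rw [← smul_eq_C_mul]
      refine lt_of_le_of_lt (degree_smul_le _ _) ?_
      refine lt_of_le_of_lt degree_le_natDegree ?_
      exact_mod_cast (by omega : b.natDegree < N)
  -- For `k = 0` the truncated bound `k - 1` does not keep `b` below the top degree when `N = 1`, so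
  -- `b = 0` is proved directly.
  have hbc : k ≠ 0 ∨ b = 0 := by
    by_cases h0 : k = 0
    · right
      rw [hb, divByMonic_eq_zero_iff hm, degree_X_pow, h0]
      simpa using degree_rep_lt hN x
    · exact Or.inl h0
  change (rep (X ^ k • x)).coeff (N - 1) = _
  rw [hs, rep_mk_of_degree_lt hN hdeg, coeff_add, coeff_X_pow_mul', if_pos (by omega),
    coeff_C_mul]
  have hb0 : b.coeff (N - 1) = 0 := by
    rcases hbc with h | h
    · exact coeff_eq_zero_of_natDegree_lt (by omega)
    · rw [h, coeff_zero]
  rw [hb0, mul_zero, add_zero, ← hab, coeff_add, coeff_X_pow_mul', if_neg (by omega), add_zero]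

theorem weight_eq_orbitCount {F : Type*} [Field F] {u : F} (hN : N ≠ 0) (x : ConstaRing F N u) :
    weight x = orbitCount (X : F[X]) (topCoeff hN) 0 N x := by
  classical
  have h1 : (rep x).support = {i ∈ Finset.range N | (rep x).coeff i ≠ 0} := by
    ext i
    simp only [mem_support_iff, Finset.mem_filter, Finset.mem_range, iff_and_self]
    intro hi
    by_contra hlt
    refine hi (coeff_eq_zero_of_degree_lt ((degree_rep_lt hN x).trans_le ?_))
    exact_mod_cast not_lt.mp hlt
  rw [weight, h1, orbitCount, Finset.card_filter, Finset.card_filter,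
    ← Finset.sum_range_reflect]
  refine Finset.sum_congr rfl fun k hk => ?_
  rw [zero_add, topCoeff_X_pow_smul hN x (Finset.mem_range.mp hk)]

theorem eq_zero_of_topCoeff {F : Type*} [Field F] {u : F} (hN : N ≠ 0) (x : ConstaRing F N u)
    (h : ∀ i, topCoeff hN ((X : F[X]) ^ i • x) = 0) : x = 0 := by
  apply weight_eq_zero
  rw [weight_eq_orbitCount hN, orbitCount]
  simp [h]

end Rep

/-! ### Roots inside the cyclic group generated by `u` -/

section Roots

set_option linter.unusedSectionVars false

variable {F : Type*} [Field F] [Finite F] (u : Fˣ)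

theorem unitRoot_pow {k : ℕ} (hk : k.Coprime (orderOf u)) : unitRoot u k ^ k = u := by
  rw [unitRoot, ← pow_mul]
  conv_rhs => rw [← pow_one u]
  rw [pow_eq_pow_iff_modEq, ← ZMod.natCast_eq_natCast_iff]
  have : NeZero (orderOf u) := ⟨(orderOf_pos u).ne'⟩
  rw [Nat.cast_mul, ZMod.natCast_zmod_val, mul_comm, ZMod.coe_mul_inv_eq_one k hk, Nat.cast_one]

theorem unitRoot_congr {k m : ℕ} (h : k ≡ m [MOD orderOf u]) : unitRoot u k = unitRoot u m := by
  rw [unitRoot, unitRoot, (ZMod.natCast_eq_natCast_iff _ _ _).mpr h]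

theorem unitRoot_mul_pow {a n : ℕ} (ha : a.Coprime (orderOf u)) (hn : n.Coprime (orderOf u)) :
    unitRoot u (a * n) ^ n = unitRoot u a := by
  rw [unitRoot, unitRoot, ← pow_mul, pow_eq_pow_iff_modEq, ← ZMod.natCast_eq_natCast_iff]
  have : NeZero (orderOf u) := ⟨(orderOf_pos u).ne'⟩
  rw [Nat.cast_mul, ZMod.natCast_zmod_val, ZMod.natCast_zmod_val]
  have h1 := ZMod.coe_mul_inv_eq_one (a * n) (ha.mul_left hn)
  have h2 := ZMod.coe_mul_inv_eq_one a ha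
  set y := ((a * n : ℕ) : ZMod (orderOf u))⁻¹
  push_cast at h1
  linear_combination (a : ZMod (orderOf u))⁻¹ * h1 - n * y * h2

end Roots

/-! ### Factorization of `X ^ (a n) - u` and the sampling ideals -/

section Factorization

set_option linter.unusedSectionVars false

variable {F : Type*} [Field F] [Finite F] {u : Fˣ} {a n : ℕ}

theorem psi_mul (ha : a.Coprime (orderOf u)) :
    psi u a n * (X ^ n - C (unitRoot u a : F)) = X ^ (a * n) - C (u : F) := by
  have h := geom_sum₂_mul (C (unitRoot u a : F)) ((X : F[X]) ^ n) a
  have h1 : psi u a n = ∑ i ∈ Finset.range a, C (unitRoot u a : F) ^ i * (X ^ n) ^ (a - 1 - i) := by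
    unfold psi
    exact Finset.sum_congr rfl fun i _ => by rw [map_pow, mul_comm]
  have h2 : C (unitRoot u a : F) ^ a = C (u : F) := by
    rw [← map_pow, ← Units.val_pow_eq_pow_val, unitRoot_pow u ha]
  rw [← h1, h2, ← pow_mul, mul_comm n a] at h
  linear_combination -h

/-- The cofactor of `w⁻¹ X - 1` in `X ^ n - w ^ n`. -/
def checkPoly (w : F) (n : ℕ) : F[X] :=
  C w * ∑ i ∈ Finset.range n, X ^ i * C w ^ (n - 1 - i)

theorem mul_checkPoly {w : F} (hw : w ≠ 0) (n : ℕ) :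
    (C w⁻¹ * X - 1) * checkPoly w n = X ^ n - C (w ^ n) := by
  have h := geom_sum₂_mul (X : F[X]) (C w) n
  have h1 : C w⁻¹ * C w = (1 : F[X]) := by rw [← C_mul, inv_mul_cancel₀ hw, C_1]
  rw [checkPoly, map_pow]
  linear_combination h + (∑ i ∈ Finset.range n, X ^ i * C w ^ (n - 1 - i)) * X * h1

theorem psiPlus_mul_checkPoly (ha : a.Coprime (orderOf u)) (hn : n.Coprime (orderOf u)) :
    psiPlus u a n * checkPoly (unitRoot u (a * n) : F) n = X ^ (a * n) - C (u : F) := by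
  rw [← psi_mul ha, psiPlus, ← unitRoot_mul_pow u ha hn, Units.val_pow_eq_pow_val,
    ← mul_checkPoly (Units.ne_zero _)]
  ring

theorem psiPlus_ne_zero (hN : a * n ≠ 0) (ha : a.Coprime (orderOf u))
    (hn : n.Coprime (orderOf u)) : psiPlus u a n ≠ 0 := by
  intro h
  have := psiPlus_mul_checkPoly ha hn
  rw [h, zero_mul] at this
  exact X_pow_sub_C_ne_zero (Nat.pos_of_ne_zero hN) (u : F) this.symm

/-- The map is multiplication by `psiPlus`, whose complementary factor is the check polynomial. The
root enters as a separate `w` so that one source ring can serve two values of `a`. -/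
theorem exists_linearMap_sampleIdeal (hN : a * n ≠ 0) (ha : a.Coprime (orderOf u))
    (hn : n.Coprime (orderOf u)) {w : F} (hw : w = unitRoot u (a * n)) :
    ∃ j : (F[X] ⧸ Ideal.span {checkPoly w n}) →ₗ[F[X]] ConstaRing F (a * n) (u : F),
      Function.Injective j ∧ ∀ y, y ∈ sampleIdeal u a n ↔ ∃ f, j f = y := by
  subst hw
  have hfac := psiPlus_mul_checkPoly ha hn
  have h0 := psiPlus_ne_zero hN ha hn
  let j : (F[X] ⧸ Ideal.span {checkPoly (unitRoot u (a * n) : F) n}) →ₗ[F[X]]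
      ConstaRing F (a * n) (u : F) :=
    Submodule.mapQ _ _ (LinearMap.mulLeft F[X] (psiPlus u a n)) (by
      rw [Ideal.span, Submodule.span_le, Set.singleton_subset_iff]
      change psiPlus u a n * _ ∈ Ideal.span {(X ^ (a * n) - C (u : F) : F[X])}
      rw [hfac]
      exact Ideal.mem_span_singleton_self _)
  have hj : ∀ p : F[X], j (Ideal.Quotient.mk _ p) = Ideal.Quotient.mk _ (psiPlus u a n * p) :=
    fun p => rfl
  refine ⟨j, ?_, fun y => ?_⟩
  · rw [injective_iff_map_eq_zero]
    intro f hf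
    obtain ⟨p, rfl⟩ := Ideal.Quotient.mk_surjective f
    rw [hj, Ideal.Quotient.eq_zero_iff_mem, Ideal.mem_span_singleton, ← hfac] at hf
    rw [Ideal.Quotient.eq_zero_iff_mem, Ideal.mem_span_singleton]
    exact (mul_dvd_mul_iff_left h0).mp hf
  · rw [sampleIdeal, Ideal.mem_span_singleton']
    constructor
    · rintro ⟨b, rfl⟩
      obtain ⟨p, rfl⟩ := Ideal.Quotient.mk_surjective b
      exact ⟨Ideal.Quotient.mk _ p, (hj p).trans ((map_mul _ _ _).trans (mul_comm _ _))⟩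
    · rintro ⟨f, rfl⟩
      obtain ⟨p, rfl⟩ := Ideal.Quotient.mk_surjective f
      exact ⟨Ideal.Quotient.mk _ p, ((hj p).trans ((map_mul _ _ _).trans (mul_comm _ _))).symm⟩

theorem checkPoly_natDegree {w : F} (hw : w ≠ 0) (hn : 0 < n) :
    (checkPoly w n).natDegree = n - 1 := by
  have h := congrArg natDegree (mul_checkPoly hw n)
  have h1 : (C w⁻¹ * X - 1 : F[X]).natDegree = 1 := by
    rw [← C_1]
    rw [sub_eq_add_neg, ← C_neg, natDegree_linear (inv_ne_zero hw)]
  have h2 : checkPoly w n ≠ 0 := by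
    intro h0
    have := mul_checkPoly hw n
    rw [h0, mul_zero] at this
    exact X_pow_sub_C_ne_zero hn _ this.symm
  have h3 : (C w⁻¹ * X - 1 : F[X]) ≠ 0 := fun h0 => by simp [h0] at h1
  rw [natDegree_mul h3 h2, h1, natDegree_X_pow_sub_C] at h
  omega

theorem checkPoly_squarefree {w : F} (hw : w ≠ 0) (hn : (n : F) ≠ 0) :
    Squarefree (checkPoly w n) := by
  refine Squarefree.squarefree_of_dvd (Dvd.intro_left _ (mul_checkPoly hw n)) ?_
  exact (separable_X_pow_sub_C _ hn (pow_ne_zero _ hw)).squarefree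

/-- The quotient `x / w` is an `n`-th root of unity, and it is not `1` because the check polynomial
takes the value `n w ^ n ≠ 0` at `w`. Its minimal polynomial is thus a competitor in `minDeg`. -/
theorem minDeg_le_finrank {K : Type*} [Field K] [Algebra F K] [Module.Finite F K] {w : F}
    (hw : w ≠ 0) (hn : (n : F) ≠ 0) {x : K} (hx : aeval x (checkPoly w n) = 0) :
    minDeg F n ≤ Module.finrank F K := by
  set W : K := algebraMap F K w with hW
  have hW0 : W ≠ 0 := (_root_.map_ne_zero _).mpr hw
  have hint : IsIntegral F (x * W⁻¹) := IsIntegral.of_finite F _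
  have hpow : x ^ n = W ^ n := by
    have h := congrArg (aeval x) (mul_checkPoly hw n)
    rw [map_mul, hx, mul_zero] at h
    simp only [map_sub, map_pow, aeval_X, aeval_C] at h
    exact (sub_eq_zero.mp h.symm)
  have hne : x ≠ W := by
    rintro rfl
    have h1 : aeval (algebraMap F K w) (checkPoly w n) = algebraMap F K (w ^ n * n) := by
      rw [aeval_algebraMap_apply, checkPoly]
      congr 1
      simp only [map_mul, map_sum, map_pow, coe_aeval_eq_eval, eval_C, eval_X]
      rw [Finset.sum_congr rfl (g := fun _ => w ^ (n - 1))]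
      · rcases Nat.eq_zero_or_pos n with rfl | h0
        · simp
        · obtain ⟨m, rfl⟩ := Nat.exists_eq_add_of_lt h0
          simp only [Finset.sum_const, Finset.card_range, nsmul_eq_mul]
          rw [show 0 + m + 1 - 1 = m by omega, show 0 + m + 1 = m + 1 by omega]
          ring
      · intro i hi
        rw [← pow_add]
        congr 1
        have := Finset.mem_range.mp hi
        omega
    rw [h1] at hx
    exact (mul_ne_zero (pow_ne_zero _ hw) hn) ((_root_.map_eq_zero _).mp hx)
  refine le_trans (Nat.sInf_le ⟨minpoly F (x * W⁻¹), minpoly.monic hint, minpoly.irreducible hint,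
    minpoly.dvd _ _ ?_, ?_, rfl⟩) (minpoly.natDegree_le (A := F) (x * W⁻¹))
  · simp only [map_sub, map_pow, aeval_X, map_one]
    rw [mul_pow, hpow, ← mul_pow, mul_inv_cancel₀ hW0, one_pow, sub_self]
  · intro h
    have h1 := minpoly.aeval F (x * W⁻¹)
    rw [h, map_sub, aeval_X, map_one, sub_eq_zero] at h1
    exact hne (by rw [← one_mul W, ← h1, inv_mul_cancel_right₀ hW0])

/-- Excludes the default `sInf ∅ = 0`: an irreducible factor of `checkPoly 1 n` cannot be `X - 1`,
since the value at `1` is `n ≠ 0`. -/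
theorem minDeg_pos (hn1 : 1 < n) (hn : (n : F) ≠ 0) : 0 < minDeg F n := by
  have hne : {d | ∃ p : F[X], p.Monic ∧ Irreducible p ∧ p ∣ X ^ n - 1 ∧ p ≠ X - 1 ∧
      p.natDegree = d}.Nonempty := by
    obtain ⟨p, hm, hirr, hdvd⟩ := exists_monic_irreducible_factor (checkPoly (1 : F) n) (by
      intro h
      have h1 := natDegree_eq_zero_of_isUnit h
      rw [checkPoly_natDegree one_ne_zero (by omega)] at h1
      omega)
    refine ⟨_, p, hm, hirr, ?_, ?_, rfl⟩
    · have h := mul_checkPoly (one_ne_zero : (1 : F) ≠ 0) n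
      rw [one_pow, C_1] at h
      rw [← h]
      exact hdvd.mul_left _
    · rintro rfl
      rw [← C_1, dvd_iff_isRoot, IsRoot.def, checkPoly] at hdvd
      simp [eval_finsetSum, hn] at hdvd
  obtain ⟨p, -, hirr, -, -, hd⟩ := Nat.sInf_mem hne
  rw [minDeg, ← hd]
  exact hirr.natDegree_pos

end Factorization

/-! ### The common ring `CheckRing w n` and weights of its images -/

section CheckQuotient

set_option linter.unusedSectionVars false

variable {F : Type*} [Field F] [Finite F] {n : ℕ} {w : F}

/-- The quotient of `F[X]` by the cofactor of `w⁻¹ X - 1` in `X ^ n - w ^ n`. -/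
abbrev CheckRing (w : F) (n : ℕ) : Type _ := F[X] ⧸ Ideal.span {checkPoly w n}

theorem finrank_checkPoly (hw : w ≠ 0) (hn : 0 < n) :
    Module.finrank F (CheckRing w n) = n - 1 := by
  rw [finrank_quotient_span_eq_natDegree, checkPoly_natDegree hw hn]

theorem finite_checkPoly (hw : w ≠ 0) (hn : 1 < n) :
    Finite (CheckRing w n) := by
  have : Module.Finite F (CheckRing w n) := by
    refine Module.finite_of_finrank_pos ?_
    rw [finrank_checkPoly hw (by omega)]
    omega
  exact Module.finite_of_finite F

theorem isReduced_checkPoly (hw : w ≠ 0) (hn : (n : F) ≠ 0) :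
    IsReduced (CheckRing w n) :=
  (Ideal.isRadical_iff_quotient_reduced _).mp
    (isRadical_iff_span_singleton.mp (checkPoly_squarefree hw hn).isRadical)

theorem card_residue_checkPoly (hw : w ≠ 0) (hn : (n : F) ≠ 0) (hn1 : 1 < n)
    (M : Ideal (CheckRing w n)) (hM : M.IsMaximal) :
    Nat.card F ^ minDeg F n ≤ Nat.card (CheckRing w n ⧸ M) := by
  have := finite_checkPoly hw hn1
  let _ : Field (CheckRing w n ⧸ M) := Ideal.Quotient.field M
  have : Finite (CheckRing w n ⧸ M) :=
    Finite.of_surjective _ Ideal.Quotient.mk_surjective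
  rw [Module.natCard_eq_pow_finrank (K := F)
    (V := CheckRing w n ⧸ M)]
  refine Nat.pow_le_pow_right (Nat.card_pos (α := F)) ?_
  let f : F[X] →ₐ[F] (CheckRing w n ⧸ M) :=
    (Ideal.Quotient.mkₐ F M).comp (Ideal.Quotient.mkₐ F _)
  refine minDeg_le_finrank hw hn (x := f X) ?_
  rw [aeval_algHom_apply, aeval_X_left_apply]
  change Ideal.Quotient.mk M (Ideal.Quotient.mk _ (checkPoly w n)) = 0
  rw [Ideal.Quotient.eq_zero_iff_mem.mpr (Ideal.mem_span_singleton_self _), map_zero]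

theorem X_pow_checkPoly (hw : w ≠ 0) (n : ℕ) :
    (Ideal.Quotient.mk _ X : CheckRing w n) ^ n =
      algebraMap F _ (w ^ n) := by
  rw [← map_pow]
  change _ = Ideal.Quotient.mk _ (C (w ^ n))
  rw [Ideal.Quotient.mk_eq_mk_iff_sub_mem, ← mul_checkPoly hw, Ideal.mem_span_singleton]
  exact dvd_mul_left _ _

theorem mk_X_pow_smul (w : F) (n k : ℕ) (y : CheckRing w n) :
    (Ideal.Quotient.mk _ X : CheckRing w n) ^ k • y = (X : F[X]) ^ k • y := by
  obtain ⟨p, rfl⟩ := Ideal.Quotient.mk_surjective y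
  rw [smul_eq_mul, ← map_pow, ← map_mul]
  rfl

/-- The image word repeats, up to nonzero scalars, the same block of length `n` altogether `a`
times. -/
theorem weight_linearMap {a : ℕ} {u : F} (hw : w ≠ 0) (hN : a * n ≠ 0)
    (j : CheckRing w n →ₗ[F[X]] ConstaRing F (a * n) u)
    (y : CheckRing w n) :
    weight (j y) = a * orbitCount (Ideal.Quotient.mk _ X : CheckRing w n)
      (topCoeff hN ∘ₗ j.restrictScalars F) 0 n y := by
  have h : ∀ m, orbitCount (Ideal.Quotient.mk _ X : CheckRing w n)
      (topCoeff hN ∘ₗ j.restrictScalars F) 0 m y =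
      orbitCount (X : F[X]) (topCoeff hN ∘ₗ j.restrictScalars F) 0 m y := by
    intro m
    classical
    unfold orbitCount
    congr 1
  rw [weight_eq_orbitCount hN, ← orbitCount_map X (topCoeff hN) j, ← h]
  refine orbitCount_mul_period (v := w ^ n) (pow_ne_zero _ hw) (fun z => ?_) a y
  rw [X_pow_checkPoly hw, algebraMap_smul]

theorem topCoeff_linearMap_nondegenerate {a : ℕ} {u : F} (hN : a * n ≠ 0)
    {j : CheckRing w n →ₗ[F[X]] ConstaRing F (a * n) u}
    (hj : Function.Injective j) (y : CheckRing w n)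
    (hy : ∀ i, (topCoeff hN ∘ₗ j.restrictScalars F)
      ((Ideal.Quotient.mk _ X : CheckRing w n) ^ i • y) = 0) : y = 0 := by
  refine (injective_iff_map_eq_zero j).mp hj _ (eq_zero_of_topCoeff hN _ fun i => ?_)
  have := hy i
  rw [mk_X_pow_smul] at this
  rw [← j.map_smul]
  exact this

end CheckQuotient

theorem mem_baseCode {F : Type*} [Field F] {u : F} {N' N : ℕ} {a' : ConstaRing F N' u}
    {a : ConstaRing F N u} {c : DoubleSpace (RingHom.id F) u N' N} :
    c ∈ baseCode a' a ↔ ∃ p : F[X], c = (p • a', p • a) := by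
  have key : ∀ (p : F[X]) (z : DoubleSpace (RingHom.id F) u N' N),
      p • z = (p • z.1, p • z.2) := by
    intro p z
    have h : p • z = (Ideal.Quotient.mk _ (p.map (RingHom.id F)) * z.1,
      Ideal.Quotient.mk _ p * z.2) := rfl
    rw [h, Polynomial.map_id]
    rfl
  refine Submodule.mem_span_singleton.trans (exists_congr fun p => ?_)
  rw [eq_comm]
  exact Eq.congr_right (key p (a', a))

/-- Every nonzero word of the code generated by `ω` has weight larger than `b`, and the code has
the largest possible dimension `n - 1`. -/
def IsGood {F : Type*} [Field F] {u : Fˣ} {α' α n : ℕ} (b : ℝ) (ω : Sample u α' α n) : Prop :=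
  (∀ c ∈ baseCode ω.1.1 ω.2.1, c ≠ 0 → b < (weight c.1 + weight c.2 : ℕ)) ∧
    Nat.card (baseCode ω.1.1 ω.2.1) = Nat.card F ^ (n - 1)

/-! ### Random codes over the residue field -/

section Sampling

set_option linter.unusedSectionVars false

variable {F : Type*} [Field F] [Finite F] {u : Fˣ} {α' α n : ℕ} {w : F}
  {j' : CheckRing w n →ₗ[F[X]] ConstaRing F (α' * n) (u : F)}
  {j : CheckRing w n →ₗ[F[X]] ConstaRing F (α * n) (u : F)}

theorem mem_baseCode_linearMap {f : CheckRing w n × CheckRing w n}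
    {c : DoubleSpace (RingHom.id F) (u : F) (α' * n) (α * n)} :
    c ∈ baseCode (j' f.1) (j f.2) ↔
      ∃ h, ((j' (h * f.1), j (h * f.2)) :
        DoubleSpace (RingHom.id F) (u : F) (α' * n) (α * n)) = c := by
  rw [mem_baseCode, (Ideal.Quotient.mk_surjective).exists]
  refine exists_congr fun p => ?_
  have h1 : j' (Ideal.Quotient.mk _ p * f.1) = p • j' f.1 := by rw [← j'.map_smul]; rfl
  have h2 : j (Ideal.Quotient.mk _ p * f.2) = p • j f.2 := by rw [← j.map_smul]; rfl
  exact eq_comm.trans (Eq.congr_left (Prod.ext h1.symm h2.symm))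

/-- One condition gives both conclusions: a nonzero `h` that kills `f` would have count `0 ≤ b`, so
`h ↦ h * f` is also injective. -/
theorem isGood_of_forall_lt (hw : w ≠ 0) (hn : 1 < n) (hN' : α' * n ≠ 0) (hN : α * n ≠ 0)
    (hj' : Function.Injective j') (hj : Function.Injective j) {b : ℝ} (hb : 0 ≤ b)
    {f : CheckRing w n × CheckRing w n} {ω : Sample u α' α n} (h₁ : ω.1.1 = j' f.1)
    (h₂ : ω.2.1 = j f.2)
    (hf : ∀ h : CheckRing w n, h ≠ 0 → b <
      ((orbitCount (Ideal.Quotient.mk _ X : CheckRing w n)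
          (topCoeff hN' ∘ₗ j'.restrictScalars F) 0 n (h * f.1) +
        orbitCount (Ideal.Quotient.mk _ X : CheckRing w n)
          (topCoeff hN ∘ₗ j.restrictScalars F) 0 n (h * f.2) : ℕ) : ℝ)) :
    IsGood ((min α' α : ℕ) * b) ω := by
  rw [IsGood, h₁, h₂]
  constructor
  · intro c hc hc0
    obtain ⟨h, rfl⟩ := mem_baseCode_linearMap.mp hc
    have h0 : h ≠ 0 := by
      rintro rfl
      refine hc0 ?_
      rw [zero_mul, zero_mul, map_zero, map_zero]
      rfl
    have hmin : 0 < min α' α :=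
      lt_min (Nat.pos_of_ne_zero (left_ne_zero_of_mul hN'))
        (Nat.pos_of_ne_zero (left_ne_zero_of_mul hN))
    refine (mul_lt_mul_of_pos_left (hf h h0) (Nat.cast_pos.mpr hmin)).trans_le ?_
    rw [weight_linearMap hw hN', weight_linearMap hw hN, ← Nat.cast_mul, mul_add]
    refine Nat.cast_le.mpr (Nat.add_le_add ?_ ?_)
    · exact Nat.mul_le_mul_right _ (min_le_left _ _)
    · exact Nat.mul_le_mul_right _ (min_le_right _ _)
  · have := finite_checkPoly hw hn
    rw [← finrank_checkPoly hw (by omega : 0 < n), ← Module.natCard_eq_pow_finrank (K := F)]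
    refine (Nat.card_congr (Equiv.ofBijective
      (fun h => (⟨_, mem_baseCode_linearMap.mpr ⟨h, rfl⟩⟩ : baseCode (j' f.1) (j f.2)))
      ⟨?_, ?_⟩)).symm
    · intro a₁ a₂ h12
      by_contra hne
      have h1 := hf (a₁ - a₂) (sub_ne_zero.mpr hne)
      have h3 := congrArg Subtype.val h12
      have h4 : a₁ * f.1 = a₂ * f.1 := hj' (congrArg Prod.fst h3)
      have h5 : a₁ * f.2 = a₂ * f.2 := hj (congrArg Prod.snd h3)
      rw [sub_mul, sub_mul, h4, h5, sub_self, sub_self] at h1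
      simp only [orbitCount, smul_zero, map_zero, ne_eq, not_true_eq_false,
        Finset.filter_false, Finset.card_empty] at h1
      simp at h1
      linarith
    · rintro ⟨c, hc⟩
      obtain ⟨h, rfl⟩ := mem_baseCode_linearMap.mp hc
      exact ⟨h, rfl⟩

theorem card_not_isGood_le (hα : 0 < α) (hα' : 0 < α') (hmod : α' ≡ α [MOD orderOf u])
    (hcop : α.Coprime (orderOf u)) (hn : 1 < n) (hnF : (n : F) ≠ 0)
    (hnt : n.Coprime (orderOf u)) {δ : ℝ} (hδ0 : 0 < δ)
    (hδ1 : δ ≤ 1 - (Nat.card F : ℝ)⁻¹) (hent : entropy (Nat.card F) δ ≤ 1 / 2) :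
    Finite (Sample u α' α n) ∧
    (Nat.card {ω : Sample u α' α n // ¬ IsGood ((min α' α : ℕ) * (2 * n * δ)) ω} : ℝ) ≤
      Nat.card (Sample u α' α n) * (n * (Real.exp (n * ((Nat.card F : ℝ) ^ minDeg F n) ^
        (-(1 - 2 * entropy (Nat.card F) δ))) - 1)) := by
  classical
  have : Fintype F := Fintype.ofFinite F
  obtain ⟨w, hw⟩ : ∃ w : F, w = unitRoot u (α * n) := ⟨_, rfl⟩
  have hw0 : w ≠ 0 := hw ▸ Units.ne_zero _
  -- The congruence `α' ≡ α` enters here: both ideals become copies of the same ring.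
  have hw' : w = unitRoot u (α' * n) := by
    rw [hw, unitRoot_congr u (hmod.mul_right n)]
  have hcop' : α'.Coprime (orderOf u) := by
    rw [Nat.coprime_iff_gcd_eq_one, hmod.gcd_eq]
    exact hcop
  have hN : α * n ≠ 0 := by positivity
  have hN' : α' * n ≠ 0 := by positivity
  obtain ⟨j, hj, hjr⟩ := exists_linearMap_sampleIdeal hN hcop hnt hw
  obtain ⟨j', hj', hjr'⟩ := exists_linearMap_sampleIdeal hN' hcop' hnt hw'
  have := finite_checkPoly hw0 hn
  have := isReduced_checkPoly hw0 hnF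
  have : Fintype (CheckRing w n) := Fintype.ofFinite _
  let e : CheckRing w n × CheckRing w n → Sample u α' α n :=
    fun f => (⟨j' f.1, (hjr' _).mpr ⟨_, rfl⟩⟩, ⟨j f.2, (hjr _).mpr ⟨_, rfl⟩⟩)
  have he : Function.Bijective e := by
    constructor
    · rintro ⟨f₁, f₂⟩ ⟨g₁, g₂⟩ h
      simp only [e, Prod.mk.injEq, Subtype.mk.injEq] at h
      exact Prod.ext (hj' h.1) (hj h.2)
    · rintro ⟨⟨y₁, hy₁⟩, ⟨y₂, hy₂⟩⟩
      obtain ⟨f₁, rfl⟩ := (hjr' _).mp hy₁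
      obtain ⟨f₂, rfl⟩ := (hjr _).mp hy₂
      exact ⟨(f₁, f₂), rfl⟩
  let E := Equiv.ofBijective e he
  refine ⟨Finite.of_surjective e he.2, ?_⟩
  have hcard : (Nat.card (Sample u α' α n) : ℝ) = (Fintype.card (CheckRing w n) : ℝ) ^ 2 := by
    rw [← Nat.card_congr E, Nat.card_prod, Nat.card_eq_fintype_card]
    push_cast
    ring
  obtain ⟨φ, hφ⟩ : ∃ φ : CheckRing w n →ₗ[F] F, φ = topCoeff hN ∘ₗ j.restrictScalars F :=
    ⟨_, rfl⟩
  obtain ⟨φ', hφ'⟩ : ∃ φ : CheckRing w n →ₗ[F] F, φ = topCoeff hN' ∘ₗ j'.restrictScalars F :=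
    ⟨_, rfl⟩
  have h1 : ∀ y : CheckRing w n,
      (∀ i, φ ((Ideal.Quotient.mk _ X : CheckRing w n) ^ i • y) = 0) → y = 0 :=
    hφ ▸ topCoeff_linearMap_nondegenerate hN hj
  have h2 : ∀ y : CheckRing w n,
      (∀ i, φ' ((Ideal.Quotient.mk _ X : CheckRing w n) ^ i • y) = 0) → y = 0 :=
    hφ' ▸ topCoeff_linearMap_nondegenerate hN' hj'
  have h3 := X_pow_checkPoly hw0 n
  have h4 : ∀ M : Ideal (CheckRing w n), M.IsMaximal →
      (Nat.card F : ℝ) ^ minDeg F n ≤ Nat.card (CheckRing w n ⧸ M) :=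
    fun M hM => by exact_mod_cast card_residue_checkPoly hw0 hnF hn M hM
  have h5 : Module.finrank F (CheckRing w n) ≤ n := by
    rw [finrank_checkPoly hw0 (by omega)]
    omega
  have h6 : (1 : ℝ) ≤ (Nat.card F : ℝ) ^ minDeg F n :=
    one_le_pow₀ (Nat.one_le_cast.mpr Nat.card_pos)
  have hmain := card_exists_low_le h1 h2 (by omega : 0 < n) (pow_ne_zero n hw0) h3 hδ0
    (by rwa [← Nat.card_eq_fintype_card]) (by rwa [← Nat.card_eq_fintype_card]) h6 h4 h5
  rw [← Nat.card_eq_fintype_card (α := F), ← hcard] at hmain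
  subst hφ hφ'
  refine le_trans (Nat.cast_le.mpr ?_) hmain
  rw [← Nat.card_eq_finsetCard]
  refine Nat.card_le_card_of_injective (fun ω => ⟨E.symm ω.1, ?_⟩) ?_
  · by_contra hnot
    refine ω.2 (isGood_of_forall_lt hw0 hn hN' hN hj' hj (by positivity) (f := E.symm ω.1)
      (congrArg (fun ω => ω.1.1) (E.apply_symm_apply ω.1)).symm
      (congrArg (fun ω => ω.2.1) (E.apply_symm_apply ω.1)).symm fun h h0 => ?_)
    by_contra hcon
    exact hnot (Finset.mem_filter.mpr ⟨Finset.mem_univ _, h, h0, not_lt.mp hcon⟩)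
  · intro ω₁ ω₂ h
    exact Subtype.ext (E.symm.injective (congrArg Subtype.val h))

end Sampling

/-! ### The embedding into the socle of the chain ring -/

section Socle

variable {R : Type*} [CommRing R] [IsLocalRing R] {S : Type*} [CommRing S]

theorem map_mul_eq_of_residue_eq {ρ : R →+* S} {c : S}
    (hc : ∀ a ∈ IsLocalRing.maximalIdeal R, ρ a * c = 0) {a b : R}
    (h : IsLocalRing.residue R a = IsLocalRing.residue R b) : ρ a * c = ρ b * c := by
  rw [← sub_eq_zero, ← sub_mul, ← map_sub]
  refine hc _ ?_
  rw [← IsLocalRing.residue_eq_zero_iff, map_sub, h, sub_self]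

theorem residue_resLift (x : IsLocalRing.ResidueField R) :
    IsLocalRing.residue R (resLift x) = x :=
  Function.surjInv_eq _ _

variable {ρ : R →+* S} {c : S} {l : R} {N : ℕ}

/-- Since `c` kills the maximal ideal, the chosen lifts are irrelevant and any polynomial lift `p`
may be used; additivity and `R[X]`-linearity then follow. -/
theorem socleMap_mk (hN : N ≠ 0) (hc : ∀ a ∈ IsLocalRing.maximalIdeal R, ρ a * c = 0)
    (p : R[X]) :
    (socleMap ρ c (Ideal.Quotient.mk _ (p.map (IsLocalRing.residue R)) :
        ConstaRing (IsLocalRing.ResidueField R) N (IsLocalRing.residue R l)) :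
      ConstaRing S N (ρ l)) = Ideal.Quotient.mk _ (p.map ρ * C c) := by
  have hm := monic_X_pow_sub_C l hN
  set r := p %ₘ (X ^ N - C l) with hr
  have h1 : rep (Ideal.Quotient.mk _ (p.map (IsLocalRing.residue R)) :
        ConstaRing (IsLocalRing.ResidueField R) N (IsLocalRing.residue R l)) =
      r.map (IsLocalRing.residue R) := by
    rw [rep_mk hN, hr, map_modByMonic _ hm]
    simp
  have hrd : r.degree < N := by
    refine (degree_modByMonic_lt _ hm).trans_eq ?_
    exact degree_X_pow_sub_C (Nat.pos_of_ne_zero hN) l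
  have h2 : ∑ j ∈ Finset.range N,
      C (ρ (resLift ((r.map (IsLocalRing.residue R)).coeff j)) * c) * X ^ j = r.map ρ * C c := by
    have hd : r.natDegree < N := by
      by_cases h0 : r = 0
      · rw [h0, natDegree_zero]; exact Nat.pos_of_ne_zero hN
      · exact (natDegree_lt_iff_degree_lt h0).mpr hrd
    rw [as_sum_range_C_mul_X_pow' (r.map ρ) (lt_of_le_of_lt natDegree_map_le hd),
      Finset.sum_mul]
    refine Finset.sum_congr rfl fun j _ => ?_
    have : ρ (resLift ((r.map (IsLocalRing.residue R)).coeff j)) * c = ρ (r.coeff j) * c :=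
      map_mul_eq_of_residue_eq hc (by rw [residue_resLift, coeff_map])
    rw [this, coeff_map, C_mul]
    ring
  rw [socleMap, h1, h2, hr, map_modByMonic _ hm, map_mul, map_mul]
  congr 1
  simpa using mk_modByMonic (l := ρ l) (N := N) (p.map ρ)

theorem exists_mk_map (x : ConstaRing (IsLocalRing.ResidueField R) N (IsLocalRing.residue R l)) :
    ∃ p : R[X], Ideal.Quotient.mk _ (p.map (IsLocalRing.residue R)) = x := by
  obtain ⟨p, rfl⟩ := Ideal.Quotient.mk_surjective x
  obtain ⟨p, rfl⟩ := map_surjective _ IsLocalRing.residue_surjective p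
  exact ⟨p, rfl⟩

theorem socleMap_add (hN : N ≠ 0) (hc : ∀ a ∈ IsLocalRing.maximalIdeal R, ρ a * c = 0)
    (x y : ConstaRing (IsLocalRing.ResidueField R) N (IsLocalRing.residue R l)) :
    (socleMap ρ c (x + y) : ConstaRing S N (ρ l)) = socleMap ρ c x + socleMap ρ c y := by
  obtain ⟨p, rfl⟩ := exists_mk_map x
  obtain ⟨r, rfl⟩ := exists_mk_map y
  rw [← map_add, ← Polynomial.map_add, socleMap_mk hN hc, socleMap_mk hN hc, socleMap_mk hN hc,
    Polynomial.map_add, add_mul, map_add]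

theorem socleMap_mul (hN : N ≠ 0) (hc : ∀ a ∈ IsLocalRing.maximalIdeal R, ρ a * c = 0)
    (g : R[X]) (x : ConstaRing (IsLocalRing.ResidueField R) N (IsLocalRing.residue R l)) :
    (socleMap ρ c (Ideal.Quotient.mk _ (g.map (IsLocalRing.residue R)) * x) :
      ConstaRing S N (ρ l)) = Ideal.Quotient.mk _ (g.map ρ) * socleMap ρ c x := by
  obtain ⟨p, rfl⟩ := exists_mk_map x
  rw [← map_mul, ← Polynomial.map_mul, socleMap_mk hN hc, socleMap_mk hN hc,
    Polynomial.map_mul, mul_assoc, map_mul]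

/-- A lift of a nonzero residue is a unit, so its product with `c ≠ 0` is nonzero; a lift of zero is
killed by `c`. -/
theorem weight_socleMap [Nontrivial S] (hN : N ≠ 0)
    (hc : ∀ a ∈ IsLocalRing.maximalIdeal R, ρ a * c = 0) (hc0 : c ≠ 0)
    (x : ConstaRing (IsLocalRing.ResidueField R) N (IsLocalRing.residue R l)) :
    weight (socleMap ρ c x : ConstaRing S N (ρ l)) = weight x := by
  set f : S[X] := ∑ j ∈ Finset.range N, C (ρ (resLift ((rep x).coeff j)) * c) * X ^ j with hf
  have hfc : ∀ i, f.coeff i = if i < N then ρ (resLift ((rep x).coeff i)) * c else 0 := by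
    intro i
    rw [hf, finsetSum_coeff]
    simp only [coeff_C_mul, coeff_X_pow, mul_ite, mul_one, mul_zero]
    simp
  have hfd : f.degree < N := (degree_lt_iff_coeff_zero _ _).mpr fun m hm => by
    rw [hfc, if_neg (not_lt.mpr hm)]
  have h1 : rep (socleMap ρ c x : ConstaRing S N (ρ l)) = f := rep_mk_of_degree_lt hN hfd
  rw [weight, weight, h1]
  congr 1
  ext i
  rw [mem_support_iff, mem_support_iff, hfc, not_iff_not]
  by_cases hi : i < N
  · rw [if_pos hi]
    constructor
    · intro h
      by_contra h0
      have hu : IsUnit (resLift ((rep x).coeff i)) := by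
        rw [← IsLocalRing.residue_ne_zero_iff_isUnit, residue_resLift]
        exact h0
      exact hc0 ((hu.map ρ).mul_right_eq_zero.mp h)
    · intro h
      refine hc _ ?_
      rw [← IsLocalRing.residue_eq_zero_iff, residue_resLift, h]
  · rw [if_neg hi, coeff_eq_zero_of_degree_lt]
    · simp
    · exact (degree_rep_lt hN x).trans_le (by exact_mod_cast not_lt.mp hi)

end Socle

/-! ### Codes over the pair of chain rings -/

section Lift

set_option linter.unusedSectionVars false

variable {R R' : Type*} [CommRing R] [IsLocalRing R] [CommRing R'] [Nontrivial R'] {ρ : R →+* R'}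
  {c' : R'} {c : R} {l : Rˣ} {α' α n : ℕ}

theorem pairMap_add (hN' : α' * n ≠ 0) (hN : α * n ≠ 0)
    (hc' : ∀ a ∈ IsLocalRing.maximalIdeal R, ρ a * c' = 0)
    (hc : ∀ a ∈ IsLocalRing.maximalIdeal R, a * c = 0)
    (x y : DoubleSpace (RingHom.id _) (residueUnit l : IsLocalRing.ResidueField R)
      (α' * n) (α * n)) :
    pairMap ρ c' c (l : R) (x + y) = pairMap ρ c' c (l : R) x + pairMap ρ c' c (l : R) y :=
  Prod.ext (socleMap_add (l := (l : R)) hN' hc' x.1 y.1)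
    (socleMap_add (ρ := RingHom.id R) (l := (l : R)) hN hc x.2 y.2)

theorem pairMap_smul (hN' : α' * n ≠ 0) (hN : α * n ≠ 0)
    (hc' : ∀ a ∈ IsLocalRing.maximalIdeal R, ρ a * c' = 0)
    (hc : ∀ a ∈ IsLocalRing.maximalIdeal R, a * c = 0) (g : R[X])
    (x : DoubleSpace (RingHom.id _) (residueUnit l : IsLocalRing.ResidueField R)
      (α' * n) (α * n)) :
    pairMap ρ c' c (l : R) (g.map (IsLocalRing.residue R) • x) =
      g • pairMap ρ c' c (l : R) x := by
  refine Prod.ext ?_ ?_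
  · refine Eq.trans ?_ (socleMap_mul (l := (l : R)) hN' hc' g x.1)
    change socleMap ρ c' (Ideal.Quotient.mk _
      ((g.map (IsLocalRing.residue R)).map (RingHom.id _)) * x.1) = _
    rw [Polynomial.map_id]
    rfl
  · refine (socleMap_mul (ρ := RingHom.id R) (l := (l : R)) hN hc g x.2).trans ?_
    rw [Polynomial.map_id]
    rfl

theorem weight_pairMap (hN' : α' * n ≠ 0) (hN : α * n ≠ 0)
    (hc' : ∀ a ∈ IsLocalRing.maximalIdeal R, ρ a * c' = 0)
    (hc : ∀ a ∈ IsLocalRing.maximalIdeal R, a * c = 0) (hc0' : c' ≠ 0) (hc0 : c ≠ 0)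
    (x : DoubleSpace (RingHom.id _) (residueUnit l : IsLocalRing.ResidueField R)
      (α' * n) (α * n)) :
    weight (pairMap ρ c' c (l : R) x).1 + weight (pairMap ρ c' c (l : R) x).2 =
      weight x.1 + weight x.2 :=
  congrArg₂ (· + ·) (weight_socleMap (l := (l : R)) hN' hc' hc0' x.1)
    (weight_socleMap (ρ := RingHom.id R) (l := (l : R)) hN hc hc0 x.2)

theorem eq_zero_of_weight {u : R} {N' N : ℕ} {x : DoubleSpace ρ u N' N}
    (h : weight x.1 + weight x.2 = 0) : x = 0 :=
  Prod.ext (weight_eq_zero (Nat.add_eq_zero_iff.mp h).1)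
    (weight_eq_zero (Nat.add_eq_zero_iff.mp h).2)

theorem weight_zero {u : R} {N' N : ℕ} (hN' : N' ≠ 0) (hN : N ≠ 0) :
    weight (0 : DoubleSpace ρ u N' N).1 + weight (0 : DoubleSpace ρ u N' N).2 = 0 := by
  have h1 : weight (0 : ConstaRing R' N' (ρ u)) = 0 := by
    rw [weight, ← map_zero (Ideal.Quotient.mk _), rep_mk hN', zero_modByMonic]
    simp
  have h2 : weight (0 : ConstaRing R N u) = 0 := by
    rw [weight, ← map_zero (Ideal.Quotient.mk _), rep_mk hN, zero_modByMonic]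
    simp
  exact congrArg₂ (· + ·) h1 h2

theorem pairMap_injective (hN' : α' * n ≠ 0) (hN : α * n ≠ 0)
    (hc' : ∀ a ∈ IsLocalRing.maximalIdeal R, ρ a * c' = 0)
    (hc : ∀ a ∈ IsLocalRing.maximalIdeal R, a * c = 0) (hc0' : c' ≠ 0) (hc0 : c ≠ 0) :
    Function.Injective (pairMap ρ c' c (l : R) :
      DoubleSpace (RingHom.id _) (residueUnit l : IsLocalRing.ResidueField R) (α' * n) (α * n) →
        DoubleSpace ρ (l : R) (α' * n) (α * n)) := by
  let f : DoubleSpace (RingHom.id _) (residueUnit l : IsLocalRing.ResidueField R)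
      (α' * n) (α * n) →+ DoubleSpace ρ (l : R) (α' * n) (α * n) :=
    AddMonoidHom.mk' (pairMap ρ c' c (l : R)) (pairMap_add hN' hN hc' hc)
  refine (injective_iff_map_eq_zero f).mpr fun x hx => eq_zero_of_weight ?_
  rw [← weight_pairMap hN' hN hc' hc hc0' hc0]
  change pairMap ρ c' c (l : R) x = 0 at hx
  rw [hx]
  exact weight_zero hN' hN

theorem exists_submodule_eq_liftedCode (hN' : α' * n ≠ 0) (hN : α * n ≠ 0)
    (hc' : ∀ a ∈ IsLocalRing.maximalIdeal R, ρ a * c' = 0)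
    (hc : ∀ a ∈ IsLocalRing.maximalIdeal R, a * c = 0)
    (ω : Sample (residueUnit l) α' α n) :
    ∃ D : DoubleCode ρ (l : R) (α' * n) (α * n),
      (D : Set (DoubleSpace ρ (l : R) (α' * n) (α * n))) = liftedCode ρ c' c l ω := by
  have hz : pairMap ρ c' c (l : R) (0 : DoubleSpace (RingHom.id _)
      (residueUnit l : IsLocalRing.ResidueField R) (α' * n) (α * n)) = 0 := by
    have := pairMap_smul hN' hN hc' hc 0 (0 : DoubleSpace (RingHom.id _)
      (residueUnit l : IsLocalRing.ResidueField R) (α' * n) (α * n))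
    rwa [zero_smul, smul_zero] at this
  refine ⟨{ carrier := liftedCode ρ c' c l ω, add_mem' := ?_, zero_mem' := ?_, smul_mem' := ?_ },
    rfl⟩
  · rintro _ _ ⟨x, hx, rfl⟩ ⟨y, hy, rfl⟩
    exact ⟨x + y, Submodule.add_mem _ hx hy, pairMap_add hN' hN hc' hc x y⟩
  · exact ⟨0, Submodule.zero_mem _, hz⟩
  · rintro g _ ⟨x, hx, rfl⟩
    exact ⟨_, Submodule.smul_mem _ _ hx, pairMap_smul hN' hN hc' hc g x⟩

theorem natCard_liftedCode (hN' : α' * n ≠ 0) (hN : α * n ≠ 0)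
    (hc' : ∀ a ∈ IsLocalRing.maximalIdeal R, ρ a * c' = 0)
    (hc : ∀ a ∈ IsLocalRing.maximalIdeal R, a * c = 0) (hc0' : c' ≠ 0) (hc0 : c ≠ 0)
    (ω : Sample (residueUnit l) α' α n) :
    Nat.card (liftedCode ρ c' c l ω) = Nat.card (baseCode ω.1.1 ω.2.1) :=
  Nat.card_image_of_injective (pairMap_injective hN' hN hc' hc hc0' hc0) _

/-- The cardinality hypothesis ensures a nonzero word, so that the infimum is attained rather than
the default `0`. -/
theorem lt_minWeight_liftedCode (hN' : α' * n ≠ 0) (hN : α * n ≠ 0)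
    (hc' : ∀ a ∈ IsLocalRing.maximalIdeal R, ρ a * c' = 0)
    (hc : ∀ a ∈ IsLocalRing.maximalIdeal R, a * c = 0) (hc0' : c' ≠ 0) (hc0 : c ≠ 0)
    {ω : Sample (residueUnit l) α' α n} {b : ℝ} (hω : IsGood b ω)
    (hcard : Nat.card (baseCode ω.1.1 ω.2.1) ≠ 1) :
    b < minWeight (liftedCode ρ c' c l ω) := by
  have hne : {k | ∃ c₁ ∈ liftedCode ρ c' c l ω, c₁ ≠ 0 ∧
      k = weight c₁.1 + weight c₁.2}.Nonempty := by
    by_contra hcon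
    refine hcard ?_
    have h0 : ∀ x ∈ baseCode ω.1.1 ω.2.1, x = 0 := by
      intro x hx
      by_contra hx0
      refine hcon ⟨_, pairMap ρ c' c (l : R) x, ⟨x, hx, rfl⟩, fun h => hx0 ?_, rfl⟩
      refine eq_zero_of_weight ?_
      rw [← weight_pairMap hN' hN hc' hc hc0' hc0, h]
      exact weight_zero hN' hN
    rw [(Submodule.eq_bot_iff _).mpr h0]
    simp
  obtain ⟨_, ⟨x, hx, rfl⟩, hx0, hk⟩ := Nat.sInf_mem hne
  rw [minWeight, hk, weight_pairMap hN' hN hc' hc hc0' hc0]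
  refine hω.1 x hx fun h => hx0 ?_
  refine eq_zero_of_weight ?_
  rw [weight_pairMap hN' hN hc' hc hc0' hc0, h]
  exact weight_zero hN' hN

end Lift

/-! ### Uniform probability and the vanishing error term -/

section Limit

theorem uniformProb_le_one {Ω : Type*} [Finite Ω] (E : Ω → Prop) : uniformProb E ≤ 1 := by
  refine div_le_one_of_le₀ ?_ (Nat.cast_nonneg _)
  exact_mod_cast Nat.card_le_card_of_injective _ Subtype.val_injective

theorem one_sub_le_uniformProb {Ω : Type*} [Finite Ω] [Nonempty Ω] {E G : Ω → Prop} {ε : ℝ}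
    (hG : (Nat.card {ω // ¬ G ω} : ℝ) ≤ Nat.card Ω * ε) (hE : ∀ ω, G ω → E ω) :
    1 - ε ≤ uniformProb E := by
  classical
  have hpos : (0 : ℝ) < Nat.card Ω := by exact_mod_cast Nat.card_pos
  rw [uniformProb, le_div_iff₀ hpos]
  have h1 : Nat.card {ω // E ω} + Nat.card {ω // ¬ E ω} = Nat.card Ω := by
    rw [← Nat.card_sum, Nat.card_congr (Equiv.sumCompl E)]
  have h2 : Nat.card {ω // ¬ E ω} ≤ Nat.card {ω // ¬ G ω} :=
    Nat.card_le_card_of_injective (fun ω => ⟨ω.1, fun h => ω.2 (hE _ h)⟩)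
      (fun a b h => Subtype.ext (Subtype.mk.inj h))
  have h1' : (Nat.card {ω // E ω} : ℝ) + Nat.card {ω // ¬ E ω} = Nat.card Ω := by exact_mod_cast h1
  have h2' : (Nat.card {ω // ¬ E ω} : ℝ) ≤ Nat.card {ω // ¬ G ω} := by exact_mod_cast h2
  nlinarith

theorem tendsto_error_zero {q : ℕ} (hq : 2 ≤ q) {n m : ℕ → ℕ} (hn : ∀ i, 1 < n i)
    (hm : ∀ i, 0 < m i)
    (hlim : Tendsto (fun i => Real.logb q (n i) / (m i : ℝ)) atTop (𝓝 0)) {γ : ℝ} (hγ : 0 < γ) :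
    Tendsto (fun i => (n i : ℝ) * (Real.exp (n i * ((q : ℝ) ^ m i) ^ (-γ)) - 1)) atTop (𝓝 0) := by
  have hq1 : (1 : ℝ) < q := by exact_mod_cast hq
  have hq0 : (0 : ℝ) < q := by linarith
  have hlogq : 0 < Real.log q := Real.log_pos hq1
  have hlb : 0 < Real.logb q 2 := Real.logb_pos hq1 (by norm_num)
  have hlog : ∀ i, Real.logb q 2 ≤ Real.logb q (n i) := fun i =>
    Real.logb_le_logb_of_le hq1 (by norm_num) (by exact_mod_cast hn i)
  -- As `n i ≥ 2`, the ratio in `hlim` dominates a positive multiple of `1 / m i`, which forces `m i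
  -- → ∞`.
  have hm_inv : Tendsto (fun i => ((m i : ℝ))⁻¹) atTop (𝓝 0) := by
    have h1 := hlim.div_const (Real.logb q 2)
    rw [zero_div] at h1
    refine squeeze_zero (fun i => by positivity) (fun i => ?_) h1
    rw [div_div, inv_eq_one_div, div_le_div_iff₀ (by have := hm i; positivity)
      (by have := hm i; positivity)]
    have : (0 : ℝ) < m i := by exact_mod_cast hm i
    nlinarith [hlog i]
  have hm_top : Tendsto (fun i => (m i : ℝ)) atTop atTop := by
    have h1 : Tendsto (fun i => ((m i : ℝ))⁻¹) atTop (𝓝[>] 0) :=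
      tendsto_nhdsWithin_iff.mpr ⟨hm_inv, Eventually.of_forall fun i => by
        have := hm i
        simp only [Set.mem_Ioi]
        positivity⟩
    have h2 := h1.inv_tendsto_nhdsGT_zero
    refine h2.congr fun i => ?_
    simp
  have hbound : Tendsto (fun i => 2 * (q : ℝ) ^ (-(γ / 2) * (m i : ℝ))) atTop (𝓝 0) := by
    have h1 : Tendsto (fun i => -(γ / 2) * (m i : ℝ)) atTop atBot :=
      hm_top.const_mul_atTop_of_neg (by linarith)
    have h2 := ((tendsto_rpow_atBot_of_base_gt_one _ hq1).comp h1).const_mul 2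
    simpa using h2
  refine squeeze_zero' (Eventually.of_forall fun i => ?_) ?_ hbound
  · refine mul_nonneg (Nat.cast_nonneg _) (sub_nonneg.mpr (Real.one_le_exp ?_))
    positivity
  -- Eventually `n ≤ q ^ (γ m / 4)`. One such factor goes into the exponent `y ≤ q ^ (-3 γ m / 4)`,
  -- one stays in front, and `exp y - 1 ≤ 2 y` leaves `2 q ^ (-γ m / 2)`.
  · filter_upwards [hlim.eventually (gt_mem_nhds (show (0 : ℝ) < γ / 4 by linarith))] with i hi
    have hm0 : (0 : ℝ) < m i := by exact_mod_cast hm i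
    have hn0 : (0 : ℝ) < n i := by have := hn i; positivity
    rw [div_lt_iff₀ hm0] at hi
    have hni : (n i : ℝ) ≤ (q : ℝ) ^ (γ / 4 * (m i : ℝ)) := by
      refine (Real.rpow_logb hq0 hq1.ne' hn0).symm.trans_le ?_
      exact Real.rpow_le_rpow_of_exponent_le hq1.le hi.le
    have hQ : ((q : ℝ) ^ m i) ^ (-γ) = (q : ℝ) ^ (-γ * (m i : ℝ)) := by
      rw [← Real.rpow_natCast, ← Real.rpow_mul hq0.le]
      congr 1
      ring
    set y := (n i : ℝ) * ((q : ℝ) ^ m i) ^ (-γ) with hy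
    have hy0 : 0 ≤ y := by positivity
    have hyle : y ≤ (q : ℝ) ^ (-(3 * γ / 4) * (m i : ℝ)) := by
      rw [hy, hQ]
      calc _ ≤ (q : ℝ) ^ (γ / 4 * (m i : ℝ)) * (q : ℝ) ^ (-γ * (m i : ℝ)) := by gcongr
        _ = _ := by
          rw [← Real.rpow_add hq0]
          congr 1
          ring
    have hy1 : y ≤ 1 := by
      refine hyle.trans (Real.rpow_le_one_of_one_le_of_nonpos hq1.le ?_)
      have : 0 < γ * m i := by positivity
      nlinarith
    have hexp : Real.exp y - 1 ≤ 2 * y := by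
      have := Real.abs_exp_sub_one_le (x := y) (by rwa [abs_of_nonneg hy0])
      rw [abs_of_nonneg hy0] at this
      exact (le_abs_self _).trans this
    calc (n i : ℝ) * (Real.exp y - 1) ≤ (q : ℝ) ^ (γ / 4 * (m i : ℝ)) *
          (2 * (q : ℝ) ^ (-(3 * γ / 4) * (m i : ℝ))) := by
          refine mul_le_mul hni (hexp.trans (by linarith)) ?_ (by positivity)
          exact sub_nonneg.mpr (Real.one_le_exp hy0)
      _ = 2 * (q : ℝ) ^ (-(γ / 2) * (m i : ℝ)) := by
          rw [mul_left_comm, ← Real.rpow_add hq0]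
          congr 2
          ring

end Limit

/-! ### Remaining arithmetic and the main theorem -/

theorem natCast_ne_zero_of_coprime_card {F : Type*} [Field F] [Finite F] {n : ℕ}
    (h : n.Coprime (Nat.card F)) : (n : F) ≠ 0 := by
  have : Fintype F := Fintype.ofFinite F
  intro h0
  have h1 : IsCoprime (n : F) (Nat.card F : F) := by
    have := (Nat.isCoprime_iff_coprime.mpr h).map (Int.castRingHom F)
    simpa using this
  rw [h0, Nat.card_eq_fintype_card, Nat.cast_card_eq_zero] at h1
  exact not_isCoprime_zero_zero h1

theorem mul_pow_pred_eq_zero {R : Type*} [CommRing R] [IsLocalRing R] {π : R} {ℓ : ℕ}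
    (hπ : Ideal.span {π} = IsLocalRing.maximalIdeal R) (hℓ : π ^ ℓ = 0) {a : R}
    (ha : a ∈ IsLocalRing.maximalIdeal R) : a * π ^ (ℓ - 1) = 0 := by
  rw [← hπ, Ideal.mem_span_singleton'] at ha
  obtain ⟨b, rfl⟩ := ha
  have h0 : ℓ ≠ 0 := by
    rintro rfl
    exact one_ne_zero (pow_zero π ▸ hℓ)
  rw [mul_assoc, mul_pow_sub_one h0, hℓ, mul_zero]

theorem lt_relDist {α' α n e' e : ℕ} {R R' : Type*} [CommRing R] [CommRing R'] {ρ : R →+* R'}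
    {l : R} {C : Set (DoubleSpace ρ l (α' * n) (α * n))} (hα : 0 < α) (hα' : 0 < α') (hn : 0 < n)
    (he : 0 < e) {δ : ℝ} (h : ((α' : ℝ) + α) * n * δ < minWeight C) :
    ((α' : ℝ) + α) / ((α' : ℝ) * e' + (α : ℝ) * e) * δ < relDist e' e C := by
  have hn' : (0 : ℝ) < n := by exact_mod_cast hn
  have hα1 : (0 : ℝ) < α := by exact_mod_cast hα
  have he1 : (0 : ℝ) < e := by exact_mod_cast he
  have hpos : 0 < (α' : ℝ) * e' + (α : ℝ) * e := by positivity
  rw [relDist]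
  push_cast
  rw [show (α' : ℝ) * n * e' + α * n * e = (α' * e' + α * e) * n by ring,
    lt_div_iff₀ (by positivity)]
  calc _ = ((α' : ℝ) + α) * n * δ := by field_simp
    _ < _ := h

end ConstaCodes

end

theorem theorem4p1
    {R R' : Type*} [CommRing R] [CommRing R']
    [ConstaCodes.IsFiniteChainRing R] [ConstaCodes.IsFiniteChainRing R']
    (ρ : R →+* R') (hρ : Function.Surjective ρ)
    (π : R) (hπ : Ideal.span {π} = IsLocalRing.maximalIdeal R)
    (π' : R') (hπ' : Ideal.span {π'} = IsLocalRing.maximalIdeal R')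
    (ℓ ℓ' : ℕ) (hℓ : π ^ ℓ = 0 ∧ π ^ (ℓ - 1) ≠ 0) (hℓ' : π' ^ ℓ' = 0 ∧ π' ^ (ℓ' - 1) ≠ 0)
    (q : ℕ) (hq : q = Nat.card (IsLocalRing.ResidueField R))
    (l : Rˣ) (t : ℕ) (ht : t = orderOf (ConstaCodes.residueUnit l))
    (α α' : ℕ) (hα : 0 < α) (hα' : 0 < α') (hmod : α' ≡ α [MOD t]) (hcop : Nat.Coprime α t)
    (n : ℕ → ℕ) (hn : ∀ i, 1 < n i) (hnqt : ∀ i, Nat.Coprime (n i) (q * t))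
    (hlim : Tendsto
      (fun i => Real.logb q (n i) / (ConstaCodes.minDeg (IsLocalRing.ResidueField R) (n i) : ℝ))
      atTop (𝓝 0))
    (δ : ℝ) (hδ : δ ∈ Set.Ioo (0 : ℝ) (1 - (q : ℝ)⁻¹))
    (hδdom : ((α' : ℝ) + α) / (2 * (min α' α : ℕ)) * δ ∈ Set.Icc (0 : ℝ) (1 - (q : ℝ)⁻¹))
    (hent : ConstaCodes.entropy q (((α' : ℝ) + α) / (2 * (min α' α : ℕ)) * δ) < 1 / 2) :
    (∀ (i : ℕ) (ω : ConstaCodes.Sample (ConstaCodes.residueUnit l) α' α (n i)),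
      ∃ D : ConstaCodes.DoubleCode ρ (l : R) (α' * n i) (α * n i),
        (D : Set (ConstaCodes.DoubleSpace ρ (l : R) (α' * n i) (α * n i))) =
          ConstaCodes.liftedCode ρ (π' ^ (ℓ' - 1)) (π ^ (ℓ - 1)) l ω) ∧
    Tendsto
      (fun i => ConstaCodes.uniformProb
        (fun ω : ConstaCodes.Sample (ConstaCodes.residueUnit l) α' α (n i) =>
          ((α' : ℝ) + α) / ((α' : ℝ) * ℓ' + (α : ℝ) * ℓ) * δ <
            ConstaCodes.relDist ℓ' ℓ
              (ConstaCodes.liftedCode ρ (π' ^ (ℓ' - 1)) (π ^ (ℓ - 1)) l ω)))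
      atTop (𝓝 1) ∧
    Tendsto
      (fun i => ConstaCodes.uniformProb
        (fun ω : ConstaCodes.Sample (ConstaCodes.residueUnit l) α' α (n i) =>
          Nat.card (ConstaCodes.liftedCode ρ (π' ^ (ℓ' - 1)) (π ^ (ℓ - 1)) l ω) =
            q ^ (n i - 1)))
      atTop (𝓝 1) := by

  have hR := (inferInstance : ConstaCodes.IsFiniteChainRing R).finite
  have hR' := (inferInstance : ConstaCodes.IsFiniteChainRing R').nontrivial
  have hF : Finite (IsLocalRing.ResidueField R) :=
    Finite.of_surjective _ IsLocalRing.residue_surjective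
  subst hq ht
  -- Locality puts the image of the maximal ideal of `R` inside that of `R'`, where `π' ^ (ℓ' - 1)`
  -- kills it.
  have hcloc : IsLocalHom ρ := hρ.isLocalHom
  have hmap : (IsLocalRing.maximalIdeal R).map ρ ≤ IsLocalRing.maximalIdeal R' :=
    ((IsLocalRing.local_hom_TFAE ρ).out 0 2).mp hcloc
  have hc : ∀ a ∈ IsLocalRing.maximalIdeal R, a * π ^ (ℓ - 1) = 0 := fun a ha =>
    ConstaCodes.mul_pow_pred_eq_zero hπ hℓ.1 ha
  have hc' : ∀ a ∈ IsLocalRing.maximalIdeal R, ρ a * π' ^ (ℓ' - 1) = 0 := fun a ha =>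
    ConstaCodes.mul_pow_pred_eq_zero hπ' hℓ'.1
      (hmap (Ideal.mem_map_of_mem ρ ha))
  have hℓ0 : 0 < ℓ := by
    refine Nat.pos_of_ne_zero ?_
    rintro rfl
    exact hℓ.2 hℓ.1
  have hN : ∀ i, α * n i ≠ 0 := fun i => by have := hn i; positivity
  have hN' : ∀ i, α' * n i ≠ 0 := fun i => by have := hn i; positivity
  have hnF : ∀ i, (n i : IsLocalRing.ResidueField R) ≠ 0 := fun i =>
    ConstaCodes.natCast_ne_zero_of_coprime_card (hnqt i).coprime_mul_right_right
  have hq2 : 2 ≤ Nat.card (IsLocalRing.ResidueField R) := Finite.one_lt_card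
  set q := Nat.card (IsLocalRing.ResidueField R) with hq
  set δ' := ((α' : ℝ) + α) / (2 * (min α' α : ℕ)) * δ with hδ'
  have hmin : (0 : ℝ) < (min α' α : ℕ) := Nat.cast_pos.mpr (lt_min hα' hα)
  have hδ0 : 0 < δ' := by
    have := hδ.1
    positivity
  have hgood := fun i => ConstaCodes.card_not_isGood_le (u := ConstaCodes.residueUnit l) hα hα' hmod
    hcop (hn i) (hnF i) (hnqt i).coprime_mul_left_right hδ0 hδdom.2 hent.le
  have hlimit := (ConstaCodes.tendsto_error_zero hq2 hn
    (fun i => ConstaCodes.minDeg_pos (hn i) (hnF i)) hlim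
    (by linarith : 0 < 1 - 2 * ConstaCodes.entropy q δ')).const_sub 1
  rw [sub_zero] at hlimit
  have hsample := fun i => (hgood i).1
  refine ⟨fun i ω => ConstaCodes.exists_submodule_eq_liftedCode (hN' i) (hN i) hc' hc ω, ?_, ?_⟩
  · refine tendsto_of_tendsto_of_tendsto_of_le_of_le hlimit tendsto_const_nhds (fun i => ?_)
      (fun i => ConstaCodes.uniformProb_le_one _)
    refine ConstaCodes.one_sub_le_uniformProb (hgood i).2 fun ω hω => ?_
    refine ConstaCodes.lt_relDist hα hα' (by have := hn i; omega) hℓ0 ?_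
    refine lt_of_eq_of_lt ?_ (ConstaCodes.lt_minWeight_liftedCode (hN' i) (hN i) hc' hc hℓ'.2 hℓ.2
      hω ?_)
    -- The factor `min α' α` cancels the denominator of `δ'`, leaving `(α' + α) n δ`.
    · rw [hδ']
      field_simp
    · rw [hω.2]
      exact (Nat.one_lt_pow (by have := hn i; omega) hq2).ne'
  · refine tendsto_of_tendsto_of_tendsto_of_le_of_le hlimit tendsto_const_nhds (fun i => ?_)
      (fun i => ConstaCodes.uniformProb_le_one _)
    refine ConstaCodes.one_sub_le_uniformProb (hgood i).2 fun ω hω => ?_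
    rw [ConstaCodes.natCard_liftedCode (hN' i) (hN i) hc' hc hℓ'.2 hℓ.2]
    exact hω.2
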